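/- Let $k$ be a field, let $1\le n\le m$, let $R=k[x_{ij}\mid 1\le i\le n,\ 1\le j\le m]$ with its standard grading and let $M=(x_{ij})$ be the generic $n\times m$ matrix. Let $<$ be the lexicographic order with $x_{11}>\dots>x_{1m}>x_{21}>\dots>x_{nm}$. Let $\Delta$ be a simplicial complex on the vertex set $[m]$ that has a face of cardinality $n$ (that is, $\dim\Delta\ge n-1$). A set $\sigma=\{\sigma_1<\dots<\sigma_\ell\}\subseteq[m]$ is a *$1$-nonface* of $\Delta$ if $\sigma\notin\Delta$ and $\sigma\setminus\{\sigma_j\}\in\Delta$ and $\sigma\setminus\{\sigma_{j+1}\}\in\Delta$ for some $1\le j<\ell$. The *generalized sparse Eagon–Northcott complex* $\mathcal C=\mathcal C^<_\bullet(\Delta,M)$ is the following complex of graded free $R$-modules. $\mathcal C_0=R$, and for $i\ge1$, $\mathcal C_i$ is free with basis the elements $g^{*(\alpha)}\otimes f_\sigma$ of degree $n+i-1$, where $\alpha\in\mathbb N^n$, $|\alpha|=i-1$, $\sigma\in\Delta$ and $|\sigma|=n+i-1$. The map $d_1$ sends $f_\sigma$ to the initial term with respect to $<$ of the maximal minor of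 $M$ on the columns in $\sigma$. For $i\ge2$ and $\sigma=\{\sigma_1<\dots<\sigma_{n+i-1}\}$, $$d_i(g^{*(\alpha)}\otimes f_\sigma)=\sum_{l:\ \alpha_l>0}\ \ \sum_{j=l+\alpha_1+\dots+\alpha_{l-1}}^{l+\alpha_1+\dots+\alpha_l}(-1)^{j+1}x_{l\sigma_j}\,g^{*(\alpha-\epsilon_l)}\otimes f_{\sigma\setminus\{\sigma_j\}} .$$ For a finitely generated graded $R$-module $N$ of initial degree $n$ (the least degree in which $N$ is nonzero) with minimal graded free resolution $F_\bullet$, the *linear strand* of $N$ is the subcomplex $F^{\mathrm{lin}}_\bullet$ of $F_\bullet$ in which $F^{\mathrm{lin}}_i$ is spanned by the basis elements of $F_i$ of degree $i+n$. Suppose that $\Delta$ has no $1$-nonfaces of cardinality $\ge n+1$. Then: 1. $\mathcal C$ is, up to the augmentation $\mathcal C_0=R$, the linear strand of a finitely generated graded $R$-module of initial degree $n$: there are a finitely generated graded $R$-module $N$ of initial degree $n$ with minimal graded free resolution $F_\bullet\to N$, an isomorphism of complexes of graded $R$-modules from $\cdots\to\mathcal C_3\to\mathcal C_2\to\mathcal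 C_1$ (with $\mathcal C_{i+1}$ placed in homological degree $i$) to $F^{\mathrm{lin}}_\bullet$, and an injective homogeneous map $N\to R$ of degree $0$ such that $d_1$ is the composite $\mathcal C_1\cong F^{\mathrm{lin}}_0\subseteq F_0\to N\to R$. 2. $H_i(\mathcal C)_{i+n-1}=0$ and $H_i(\mathcal C)_{i+n}=0$ for all $i\ge1$. -/

import Mathlib

open MvPolynomial

universe u

noncomputable section

/-! ### Complexes of graded free modules over a standard graded polynomial ring -/

/-- A complex `⋯ → X 2 → X 1 → X 0` of finitely generated graded free modules over the standard
graded polynomial ring `k[V]`, with chosen homogeneous bases: `X i` is the free module on `B i`,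
the basis vector `b` sits in degree `deg i b`, and the differentials are homogeneous of degree 0. -/
structure GradedFreeComplex (V : Type) (k : Type u) [Field k] where
  B : ℕ → Type
  finite_B : ∀ i, Finite (B i)
  deg : ∀ i, B i → ℕ
  d : ∀ i, (B (i + 1) →₀ MvPolynomial V k) →ₗ[MvPolynomial V k] (B i →₀ MvPolynomial V k)
  homogeneous_d : ∀ i b c s, (d i (Finsupp.single b 1) c).coeff s ≠ 0 →
    s.degree + deg i c = deg (i + 1) b
  d_comp_d : ∀ i, d i ∘ₗ d (i + 1) = 0

namespace GradedFreeComplex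

variable {V : Type} {k : Type u} [Field k] (C : GradedFreeComplex V k)

/-- The module in homological degree `i`. -/
abbrev X (i : ℕ) : Type u := C.B i →₀ MvPolynomial V k

/-- The homogeneous component of internal degree `e` of `X i`. -/
def piece (i e : ℕ) : AddSubgroup (C.X i) where
  carrier := {v | ∀ c s, (v c).coeff s ≠ 0 → s.degree + C.deg i c = e}
  zero_mem' := by intro c s h; simp at h
  add_mem' := by
    intro v w hv hw c s h
    by_cases h1 : (v c).coeff s = 0
    · refine hw c s fun h2 => h ?_
      simp [h1, h2]
    · exact hv c s h1
  neg_mem' := by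
    intro v hv c s h
    refine hv c s fun h1 => h ?_
    simp [h1]

/-- The cycles in homological degree `i`. -/
def cycles : (i : ℕ) → AddSubgroup (C.X i)
  | 0 => ⊤
  | i + 1 => (C.d i).toAddMonoidHom.ker

/-- The component `H_i(C)_e` of internal degree `e` of the `i`-th homology: cycles of internal
degree `e` modulo boundaries of elements of internal degree `e`. -/
abbrev homology (i e : ℕ) : Type u :=
  ↥(C.cycles i ⊓ C.piece i e) ⧸
    ((C.piece (i + 1) e).map (C.d i).toAddMonoidHom).addSubgroupOf (C.cycles i ⊓ C.piece i e)

/-- The complex `⋯ → X 3 → X 2 → X 1`, reindexed to start in homological degree `0`. -/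
def tail : GradedFreeComplex V k where
  B i := C.B (i + 1)
  finite_B i := C.finite_B (i + 1)
  deg i := C.deg (i + 1)
  d i := C.d (i + 1)
  homogeneous_d i := C.homogeneous_d (i + 1)
  d_comp_d i := C.d_comp_d (i + 1)

/-- The summand of `X i` spanned by the basis vectors of degree `i + n`. If `C` is a minimal free
resolution of a module with initial degree `n`, these submodules form its linear strand. -/
def linearPart (n i : ℕ) : Submodule (MvPolynomial V k) (C.X i) :=
  Submodule.span _ {v | ∃ b, C.deg i b = i + n ∧ v = Finsupp.single b 1}

end GradedFreeComplex

/-- `𝒩` makes the `k[V]`-module `N` a (nonnegatively) graded module over `k[V]` with its standard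
grading. -/
structure IsGradedModule {V : Type} {k : Type u} [Field k] {N : Type u} [AddCommGroup N]
    [Module (MvPolynomial V k) N] (𝒩 : ℕ → AddSubgroup N) : Prop where
  isInternal : DirectSum.IsInternal 𝒩
  smul_mem : ∀ (i j : ℕ) (r : MvPolynomial V k) (x : N),
    r ∈ homogeneousSubmodule V k i → x ∈ 𝒩 j → r • x ∈ 𝒩 (i + j)

/-- The initial degree of a graded module, the least degree of a nonzero homogeneous component,
is `n`. -/
def HasInitialDegree {N : Type u} [AddCommGroup N] (𝒩 : ℕ → AddSubgroup N) (n : ℕ) : Prop :=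
  𝒩 n ≠ ⊥ ∧ ∀ j < n, 𝒩 j = ⊥

/-- A minimal graded free resolution of the graded module `(N, 𝒩)`. -/
structure MinimalFreeResolution {V : Type} {k : Type u} [Field k] {N : Type u} [AddCommGroup N]
    [Module (MvPolynomial V k) N] (𝒩 : ℕ → AddSubgroup N) where
  F : GradedFreeComplex V k
  ε : F.X 0 →ₗ[MvPolynomial V k] N
  homogeneous_ε : ∀ b, ε (Finsupp.single b 1) ∈ 𝒩 (F.deg 0 b)
  surjective_ε : Function.Surjective ε
  exact_zero : LinearMap.ker ε = LinearMap.range (F.d 0)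
  exact_succ : ∀ i, LinearMap.ker (F.d i) = LinearMap.range (F.d (i + 1))
  minimal : ∀ i b c, constantCoeff (F.d i (Finsupp.single b 1) c) = 0

/-- An isomorphism of complexes of graded modules from `G` onto the linear strand (starting in
degree `n`) of the complex `F`, written as an injective chain map into `F` whose image is the
linear strand. -/
structure LinearStrandIso {V : Type} {k : Type u} [Field k] (G F : GradedFreeComplex V k)
    (n : ℕ) where
  φ : ∀ i, G.X i →ₗ[MvPolynomial V k] F.X i
  injective : ∀ i, Function.Injective (φ i)
  range_eq : ∀ i, LinearMap.range (φ i) = F.linearPart n i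
  homogeneous : ∀ i e v, v ∈ G.piece i e → φ i v ∈ F.piece i e
  comm : ∀ i v, φ i (G.d i v) = F.d i (φ (i + 1) v)

/-- The complex `C`, with `C.X 0` regarded as an augmentation, is the linear strand of the graded
module `(N, 𝒩)` of initial degree `n`: the part `⋯ → C.X 2 → C.X 1` is isomorphic to the linear
strand of a minimal graded free resolution `F` of `N`, and the last map `C.X 1 → C.X 0` is the
composite of this isomorphism, the augmentation `F.X 0 → N`, and a homogeneous embedding of `N`
into `C.X 0`. -/
def IsAugmentedLinearStrand {V : Type} {k : Type u} [Field k] (C : GradedFreeComplex V k)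
    {N : Type u} [AddCommGroup N] [Module (MvPolynomial V k) N] (𝒩 : ℕ → AddSubgroup N)
    (n : ℕ) : Prop :=
  ∃ (P : MinimalFreeResolution (V := V) (k := k) 𝒩) (Φ : LinearStrandIso C.tail P.F n)
    (ι : N →ₗ[MvPolynomial V k] C.X 0),
    Function.Injective ι ∧ (∀ e, ∀ x ∈ 𝒩 e, ι x ∈ C.piece 0 e) ∧
      ∀ v : C.X 1, C.d 0 v = ι (P.ε (Φ.φ 0 v))

/-! ### Nonfaces -/

/-- `σ = {σ_0 < σ_1 < ⋯}` is an `i`-nonface of `Δ`: it is not a face, but for some `j` all of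
`σ_j, …, σ_{j+i}` exist and removing any one of them from `σ` gives a face. -/
def IsNonface {m : ℕ} (Δ : PreAbstractSimplicialComplex (Fin m)) (i : ℕ) (σ : Finset (Fin m)) :
    Prop :=
  σ ∉ Δ ∧ ∃ (j : ℕ) (h : j + i < σ.card), ∀ (l : ℕ) (hl : l ≤ i),
    σ.erase (σ.orderEmbOfFin rfl ⟨j + l, by omega⟩) ∈ Δ

/-! ### The generalized sparse Eagon-Northcott complex -/

namespace SparseEN

variable {n m : ℕ} {k : Type u} [Field k]

/-- The variables `x_{ij}`, ordered row by row: `x_{11}, …, x_{1m}, x_{21}, …`. -/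
abbrev Vars (n m : ℕ) : Type := Fin n ×ₗ Fin m

variable (n m k) in
/-- The coordinate ring of `n × m` matrices. -/
abbrev Ring : Type u := MvPolynomial (Vars n m) k

variable (n m k) in
/-- The generic `n × m` matrix. -/
def genericMatrix : Matrix (Fin n) (Fin m) (Ring n m k) :=
  Matrix.of fun i j => X (toLex (i, j))

variable (k) in
/-- The maximal minor of the generic matrix on the columns in `σ`, which is the coefficient of
`M(f_σ)` at the basis vector `g_1 ∧ ⋯ ∧ g_n`. -/
def minor (σ : Finset (Fin m)) (h : σ.card = n) : Ring n m k :=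
  ((genericMatrix n m k).submatrix id (σ.orderEmbOfFin h)).det

variable (k) in
/-- The initial term of a maximal minor, for the lexicographic order with
`x_{11} > ⋯ > x_{1m} > x_{21} > ⋯`. -/
def initialMinor (σ : Finset (Fin m)) (h : σ.card = n) : Ring n m k :=
  (MonomialOrder.lex (σ := Vars n m)).leadingTerm (minor k σ h)

/-- The position of `a` in the increasing enumeration of `σ`, counted from `0`. -/
def pos (σ : Finset (Fin m)) (a : Fin m) : ℕ := (σ.filter (· < a)).card

/-- The set of pairs `(i, I_{i+j})` with `α_i > 0` and
`α_1 + ⋯ + α_{i-1} ≤ j ≤ α_1 + ⋯ + α_i`. Rows and positions are counted from `0` here, which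
changes both `i` and the position `i + j` by one. -/
def indexSet (α : Fin n → ℕ) (I : Finset (Fin m)) : Finset (Fin n × Fin m) :=
  Finset.univ.filter fun q => 0 < α q.1 ∧ q.2 ∈ I ∧
    q.1 + ∑ l ∈ Finset.Iio q.1, α l ≤ pos I q.2 ∧ pos I q.2 ≤ q.1 + ∑ l ∈ Finset.Iic q.1, α l

/-- The pairs `(α, σ)` that index the basis elements `g^{*(α)} ⊗ f_σ` of the module in homological
degree `i + 1`. -/
abbrev Idx (n : ℕ) (Δ : PreAbstractSimplicialComplex (Fin m)) (i : ℕ) : Type :=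
  {p : (Fin n → ℕ) × Finset (Fin m) // p.2 ∈ Δ ∧ p.2.card = n + i ∧ ∑ l, p.1 l = i}

variable {Δ : PreAbstractSimplicialComplex (Fin m)}

theorem sum_sub_single (α : Fin n → ℕ) (i : Fin n) (hi : 0 < α i) (s : Finset (Fin n)) :
    ∑ l ∈ s, (α - Pi.single i 1 : Fin n → ℕ) l + (if i ∈ s then 1 else 0) = ∑ l ∈ s, α l := by
  have : ∀ l, α l = (α - Pi.single i 1 : Fin n → ℕ) l + (if i = l then 1 else 0) := by
    intro l
    by_cases h : i = l
    · subst h; simp; omega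
    · simp [h, Ne.symm h]
  rw [Finset.sum_congr rfl fun l _ => this l, Finset.sum_add_distrib]
  simp

/-- The index `(α - ε_i, σ ∖ a)` for `(i, a)` in the indexing set of `(α, σ)`. -/
def Idx.remove {i : ℕ} (b : Idx n Δ (i + 1)) (q : Fin n × Fin m)
    (hq : q ∈ indexSet b.1.1 b.1.2) : Idx n Δ i :=
  ⟨(b.1.1 - Pi.single q.1 1, b.1.2.erase q.2), by
    have hb := b.2
    simp only [indexSet, Finset.mem_filter, Finset.mem_univ, true_and] at hq
    have hn : 0 < n := q.1.pos
    have hc : (b.1.2.erase q.2).card = n + i := by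
      have := hb.2.1
      rw [Finset.card_erase_of_mem hq.2.1]; omega
    refine ⟨(Δ.isRelLowerSet_faces hb.1).2 (Finset.erase_subset _ _) ?_, hc, ?_⟩
    · exact Finset.card_pos.1 (show 0 < (b.1.2.erase q.2).card by omega)
    · have := sum_sub_single b.1.1 q.1 hq.1 Finset.univ
      simp only [Finset.mem_univ, if_true] at this
      have h2 := hb.2.2
      simp only
      omega⟩

variable (n Δ) in
/-- Basis of the complex: one element in homological degree `0` (the vector `g_1 ∧ ⋯ ∧ g_n`), and
the elements `g^{*(α)} ⊗ f_σ` in positive homological degree. -/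
abbrev Basis : ℕ → Type
  | 0 => Unit
  | i + 1 => Idx n Δ i

variable (n Δ) in
/-- The internal degrees of the basis elements. -/
def degree : (i : ℕ) → Basis n Δ i → ℕ
  | 0, _ => 0
  | i + 1, _ => n + i

theorem card_eq (b : Idx n Δ 0) : b.1.2.card = n := b.2.2.1

/-- The image of a basis element of homological degree `i + 2` under the differential. The sign is
`(-1)^{j+1}` where `j` is the position counted from `1`. -/
def dIdx {i : ℕ} (b : Idx n Δ (i + 1)) : Idx n Δ i →₀ Ring n m k :=
  ∑ q ∈ (indexSet b.1.1 b.1.2).attach,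
    Finsupp.single (b.remove q.1 q.2) ((-1) ^ pos b.1.2 q.1.2 * X (toLex q.1))

/-- The image of a basis element under the differential. -/
def dBasis : (i : ℕ) → Basis n Δ (i + 1) → (Basis n Δ i →₀ Ring n m k)
  | 0, (b : Idx n Δ 0) => Finsupp.single () (initialMinor k b.1.2 (card_eq b))
  | i + 1, (b : Idx n Δ (i + 1)) => (dIdx b : Idx n Δ i →₀ Ring n m k)

/-- The differential. -/
def diff (i : ℕ) :
    (Basis n Δ (i + 1) →₀ Ring n m k) →ₗ[Ring n m k] (Basis n Δ i →₀ Ring n m k) :=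
  Finsupp.linearCombination _ (dBasis i)

theorem pos_erase {σ : Finset (Fin m)} {a : Fin m} (ha : a ∈ σ) (b : Fin m) :
    pos (σ.erase a) b + (if a < b then 1 else 0) = pos σ b := by
  unfold pos
  rw [Finset.filter_erase]
  split_ifs with h
  · exact Finset.card_erase_add_one (by simp [ha, h])
  · rw [Finset.erase_eq_of_notMem (by simp [h])]; rfl

theorem pos_lt {σ : Finset (Fin m)} {a b : Fin m} (ha : a ∈ σ) (h : a < b) :
    pos σ a < pos σ b := by
  apply Finset.card_lt_card
  rw [Finset.ssubset_iff_of_subset]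
  · exact ⟨a, by simp [ha, h], by simp⟩
  · intro c hc
    simp only [Finset.mem_filter] at hc ⊢
    exact ⟨hc.1, hc.2.trans h⟩

theorem indexSet_swap {α : Fin n → ℕ} {σ : Finset (Fin m)} {q r : Fin n × Fin m}
    (hq : q ∈ indexSet α σ) (hr : r ∈ indexSet (α - Pi.single q.1 1) (σ.erase q.2)) :
    r ∈ indexSet α σ ∧ q ∈ indexSet (α - Pi.single r.1 1) (σ.erase r.2) := by
  obtain ⟨i, a⟩ := q
  obtain ⟨j, b⟩ := r
  simp only [indexSet, Finset.mem_filter, Finset.mem_univ, true_and, Finset.mem_erase] at hq hr ⊢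
  obtain ⟨hi, ha, h1, h2⟩ := hq
  obtain ⟨hj, ⟨hba, hb⟩, h3, h4⟩ := hr
  have hj' : 0 < α j := lt_of_lt_of_le hj (by simp)
  have e1 := sum_sub_single α i hi (Finset.Iio j)
  have e2 := sum_sub_single α i hi (Finset.Iic j)
  have e3 := sum_sub_single α j hj' (Finset.Iio i)
  have e4 := sum_sub_single α j hj' (Finset.Iic i)
  have p1 := pos_erase ha b
  have p2 := pos_erase hb a
  have mono : ∀ x y : Fin n, x < y → ∑ l ∈ Finset.Iic x, α l ≤ ∑ l ∈ Finset.Iio y, α l := by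
    intro x y hxy
    apply Finset.sum_le_sum_of_subset
    intro l hl
    simp only [Finset.mem_Iic, Finset.mem_Iio] at hl ⊢
    exact lt_of_le_of_lt hl hxy
  simp only [Finset.mem_Iio, Finset.mem_Iic] at e1 e2 e3 e4
  have hab : a < b → pos σ a < pos σ b := pos_lt ha
  have hba' : b < a → pos σ b < pos σ a := pos_lt hb
  have hne : a < b ∨ b < a := lt_or_gt_of_ne (Ne.symm hba)
  rcases lt_trichotomy i j with hij | hij | hij
  · have hm := mono i j hij
    have hv : (i : ℕ) < j := hij
    simp only [hij, hij.le, hij.not_gt, hij.not_ge, if_true, if_false] at e1 e2 e3 e4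
    have hα : 0 < (α - Pi.single j 1 : Fin n → ℕ) i := by
      simp [hij.ne, hi]
    rcases hne with h | h
    · have := hab h
      simp only [h, h.not_gt, if_true, if_false] at p1 p2
      refine ⟨⟨hj', hb, ?_, ?_⟩, hα, ⟨Ne.symm hba, ha⟩, ?_, ?_⟩ <;> omega
    · have := hba' h
      simp only [h, h.not_gt, if_true, if_false] at p1 p2
      omega
  · subst hij
    simp only [lt_irrefl, le_refl, if_true, if_false] at e1 e2 e3 e4
    rcases hne with h | h
    · have := hab h
      simp only [h, h.not_gt, if_true, if_false] at p1 p2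
      refine ⟨⟨hj', hb, ?_, ?_⟩, hj, ⟨Ne.symm hba, ha⟩, ?_, ?_⟩ <;> omega
    · have := hba' h
      simp only [h, h.not_gt, if_true, if_false] at p1 p2
      refine ⟨⟨hj', hb, ?_, ?_⟩, hj, ⟨Ne.symm hba, ha⟩, ?_, ?_⟩ <;> omega
  · have hm := mono j i hij
    have hv : (j : ℕ) < i := hij
    simp only [hij, hij.le, hij.not_gt, hij.not_ge, if_true, if_false] at e1 e2 e3 e4
    have hα : 0 < (α - Pi.single j 1 : Fin n → ℕ) i := by
      simp [hij.ne', hi]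
    rcases hne with h | h
    · have := hab h
      simp only [h, h.not_gt, if_true, if_false] at p1 p2
      omega
    · have := hba' h
      simp only [h, h.not_gt, if_true, if_false] at p1 p2
      refine ⟨⟨hj', hb, ?_, ?_⟩, hα, ⟨Ne.symm hba, ha⟩, ?_, ?_⟩ <;> omega

theorem sign_swap {R : Type*} [CommRing R] {σ : Finset (Fin m)} {a b : Fin m} (ha : a ∈ σ)
    (hb : b ∈ σ) (hab : a ≠ b) (x y : R) :
    ((-1) ^ pos σ a * x) * ((-1) ^ pos (σ.erase a) b * y) +
      ((-1) ^ pos σ b * y) * ((-1) ^ pos (σ.erase b) a * x) = 0 := by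
  have p1 := pos_erase ha b
  have p2 := pos_erase hb a
  rcases lt_or_gt_of_ne hab with h | h
  · simp only [h, h.not_gt, if_true, if_false, add_zero] at p1 p2
    rw [← p1, p2, pow_succ]; ring
  · simp only [h, h.not_gt, if_true, if_false, add_zero] at p1 p2
    rw [← p2, p1, pow_succ]; ring

theorem diff_single (i : ℕ) (b : Basis n Δ (i + 1)) (r : Ring n m k) :
    diff i (Finsupp.single b r) = r • dBasis i b :=
  Finsupp.linearCombination_single _ _ _

theorem sum_dIdx {i : ℕ} (b : Idx n Δ (i + 2)) :
    ∑ q ∈ (indexSet b.1.1 b.1.2).attach, ((-1) ^ pos b.1.2 q.1.2 * X (toLex q.1) : Ring n m k) •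
      (dIdx (b.remove q.1 q.2) : Idx n Δ i →₀ Ring n m k) = 0 := by
  simp only [dIdx, Finset.smul_sum, Finsupp.smul_single, smul_eq_mul]
  rw [Finset.sum_sigma']
  have key : ∀ p : (q : {x // x ∈ indexSet b.1.1 b.1.2}) × {x // x ∈ indexSet
      (b.remove q.1 q.2).1.1 (b.remove q.1 q.2).1.2}, p.1.1.2 ∈ b.1.2 ∧ p.2.1.2 ∈ b.1.2 ∧
      p.1.1.2 ≠ p.2.1.2 := by
    rintro ⟨⟨q, hq⟩, ⟨r, hr⟩⟩
    simp only [Idx.remove, indexSet, Finset.mem_filter, Finset.mem_univ, true_and,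
      Finset.mem_erase] at hq hr ⊢
    exact ⟨hq.2.1, hr.2.1.2, Ne.symm hr.2.1.1⟩
  refine Finset.sum_involution (fun p _ => ⟨⟨p.2.1, (indexSet_swap p.1.2 p.2.2).1⟩,
    ⟨p.1.1, (indexSet_swap p.1.2 p.2.2).2⟩⟩) ?_ ?_ ?_ ?_
  · intro p _
    have e : (b.remove p.2.1 (indexSet_swap p.1.2 p.2.2).1).remove p.1.1
        (indexSet_swap p.1.2 p.2.2).2 = (b.remove p.1.1 p.1.2).remove p.2.1 p.2.2 := by
      apply Subtype.ext
      simp only [Idx.remove]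
      rw [Finset.erase_right_comm, tsub_right_comm]
    simp only [e]
    rw [← Finsupp.single_add]
    rw [Finsupp.single_eq_zero]
    obtain ⟨h1, h2, h3⟩ := key p
    exact sign_swap h1 h2 h3 _ _
  · intro p _ _ h
    have := congrArg (fun z => z.1.1.2) h
    exact (key p).2.2 this.symm
  · intro p _
    simp
  · intro p _
    rfl

theorem diff_diff_succ (i : ℕ) :
    (diff (i + 1) ∘ₗ diff (i + 2) : (Basis n Δ (i + 3) →₀ Ring n m k) →ₗ[Ring n m k] _) = 0 := by
  refine Finsupp.lhom_ext fun b r => ?_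
  rw [LinearMap.comp_apply, diff_single, map_smul]
  have : diff (i + 1) (dBasis (i + 2) b) = (0 : Basis n Δ (i + 1) →₀ Ring n m k) := by
    refine Eq.trans ?_ (sum_dIdx b)
    refine (map_sum (diff (i + 1)) _ _).trans (Finset.sum_congr rfl fun q _ => ?_)
    exact diff_single (i + 1) _ _
  rw [this, smul_zero, LinearMap.zero_apply]

/-- The exponent vector of `∏ i, x_{p(i), s(i)}`. -/
def permExp (s : Fin n → Fin m) (p : Equiv.Perm (Fin n)) : Vars n m →₀ ℕ :=
  ∑ i, Finsupp.single (toLex (p i, s i)) 1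

theorem permExp_apply (s : Fin n → Fin m) (p : Equiv.Perm (Fin n)) (r : Fin n) (c : Fin m) :
    permExp s p (toLex (r, c)) = if s (p.symm r) = c then 1 else 0 := by
  rw [permExp, Finsupp.finsetSum_apply, Finset.sum_eq_single (p.symm r)]
  · simp [Finsupp.single_apply]
  · intro i _ hi
    rw [Finsupp.single_apply, if_neg]
    intro h
    apply hi
    have := congrArg (fun z => (ofLex z).1) h
    simp only [ofLex_toLex] at this
    rw [← this, Equiv.symm_apply_apply]
  · simp

theorem permExp_lt {s : Fin n → Fin m} (hs : StrictMono s) {p : Equiv.Perm (Fin n)}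
    (hp : p ≠ 1) : toLex (permExp s p) < toLex (permExp s 1) := by
  have hex : ∃ r, p.symm r ≠ r := by
    by_contra! h
    apply hp
    ext r
    have := h (p r)
    rw [Equiv.symm_apply_apply] at this
    simp [← this]
  obtain ⟨r, hr, hmin⟩ := WellFounded.has_min (wellFounded_lt (α := Fin n)) {r | p.symm r ≠ r} hex
  have hfix : ∀ r' < r, p.symm r' = r' := fun r' h => by
    by_contra h'
    exact hmin r' h' h
  have hgt : r < p.symm r := by
    rcases lt_trichotomy (p.symm r) r with h | h | h
    · have := hfix _ h
      exact absurd (p.symm.injective this) h.ne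
    · exact absurd h hr
    · exact h
  rw [Finsupp.Lex.lt_iff]
  refine ⟨toLex (r, s r), ?_, ?_⟩
  · intro w hw
    obtain ⟨⟨r', c⟩, rfl⟩ := toLex.surjective w
    change permExp s p (toLex (r', c)) = permExp s 1 (toLex (r', c))
    rw [permExp_apply, permExp_apply]
    rw [Prod.Lex.toLex_lt_toLex] at hw
    rcases hw with h | ⟨h, h'⟩
    · rw [hfix r' h]; rfl
    · simp only at h h'
      subst h
      rw [if_neg ((h'.trans (hs hgt)).ne'), if_neg]
      exact h'.ne'
  · change permExp s p (toLex (r, s r)) < permExp s 1 (toLex (r, s r))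
    rw [permExp_apply, permExp_apply, if_neg, if_pos (show s ((1 : Equiv.Perm (Fin n)).symm r) = s r from rfl)]
    · exact Nat.zero_lt_one
    · exact fun h => hr (hs.injective h)

theorem minor_eq (σ : Finset (Fin m)) (h : σ.card = n) :
    minor k σ h = ∑ p : Equiv.Perm (Fin n),
      monomial (permExp (σ.orderEmbOfFin h) p) (((Equiv.Perm.sign p : ℤˣ) : ℤ) : k) := by
  rw [minor, Matrix.det_apply']
  refine Finset.sum_congr rfl fun p _ => ?_
  simp only [Matrix.submatrix_apply, genericMatrix, Matrix.of_apply, id, X, permExp]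
  rw [← monomial_sum_one, ← map_intCast (C : k →+* Ring n m k), C_mul_monomial, mul_one]

/-- The initial term of a maximal minor is its diagonal term. -/
theorem initialMinor_eq (σ : Finset (Fin m)) (h : σ.card = n) :
    initialMinor k σ h = ∏ i, X (toLex (i, σ.orderEmbOfFin h i)) := by
  set s := σ.orderEmbOfFin h with hsdef
  have hs : StrictMono s := s.strictMono
  have hc : (minor k σ h).coeff (permExp s 1) = 1 := by
    rw [minor_eq, coeff_sum, Finset.sum_eq_single 1]
    · simp [← hsdef]
    · intro p _ hp
      rw [coeff_monomial, if_neg]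
      intro he
      exact (permExp_lt hs hp).ne (congrArg toLex he)
    · simp
  have hdeg : (MonomialOrder.lex (σ := Vars n m)).degree (minor k σ h) = permExp s 1 := by
    apply (MonomialOrder.lex (σ := Vars n m)).toSyn.injective
    apply le_antisymm
    · rw [MonomialOrder.degree_le_iff]
      intro c hcs
      rw [mem_support_iff, minor_eq, coeff_sum] at hcs
      obtain ⟨p, -, hp⟩ := Finset.exists_ne_zero_of_sum_ne_zero hcs
      rw [coeff_monomial] at hp
      have hpc : permExp s p = c := by
        by_contra hne
        exact hp (if_neg hne)
      rw [MonomialOrder.lex_le_iff, ← hpc]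
      by_cases hp1 : p = 1
      · rw [hp1]
      · exact (permExp_lt hs hp1).le
    · apply MonomialOrder.le_degree
      rw [mem_support_iff, hc]
      exact one_ne_zero
  rw [initialMinor, MonomialOrder.leadingTerm, MonomialOrder.leadingCoeff, hdeg, hc, permExp,
    monomial_sum_one]
  rfl

/-- The variable in row `r`, or `0` if there is no such row. -/
def xNat (r : ℕ) (a : Fin m) : Ring n m k := if h : r < n then X (toLex (⟨r, h⟩, a)) else 0

theorem pos_orderEmbOfFin (σ : Finset (Fin m)) (h : σ.card = n) (i : Fin n) :
    pos σ (σ.orderEmbOfFin h i) = i := by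
  have : σ.filter (· < σ.orderEmbOfFin h i) =
      (Finset.Iio i).map (σ.orderEmbOfFin h).toEmbedding := by
    ext a
    simp only [Finset.mem_filter, Finset.mem_map, Finset.mem_Iio, RelEmbedding.coe_toEmbedding]
    constructor
    · rintro ⟨ha, hlt⟩
      have : a ∈ Set.range (σ.orderEmbOfFin h) := by
        rw [Finset.range_orderEmbOfFin]; exact ha
      obtain ⟨j, rfl⟩ := this
      exact ⟨j, by simpa using hlt, rfl⟩
    · rintro ⟨j, hj, rfl⟩
      exact ⟨Finset.orderEmbOfFin_mem _ _ _, by simpa using hj⟩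
  rw [pos, this, Finset.card_map, Fin.card_Iio]

theorem initialMinor_eq_prod (σ : Finset (Fin m)) (h : σ.card = n) :
    initialMinor k σ h = ∏ a ∈ σ, xNat (pos σ a) a := by
  have hσ : σ = Finset.univ.map (σ.orderEmbOfFin h).toEmbedding := by
    apply Finset.coe_injective
    simp
  have : ∏ a ∈ σ, (xNat (pos σ a) a : Ring n m k) =
      ∏ a ∈ Finset.univ.map (σ.orderEmbOfFin h).toEmbedding, xNat (pos σ a) a := by
    rw [← hσ]
  rw [initialMinor_eq, this, Finset.prod_map]
  refine Finset.prod_congr rfl fun i _ => ?_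
  simp only [RelEmbedding.coe_toEmbedding, pos_orderEmbOfFin, xNat, i.2, dif_pos]

theorem mul_initialMinor {σ : Finset (Fin m)} {i : Fin n} {a : Fin m} (ha : a ∈ σ)
    (hp : pos σ a = i ∨ pos σ a = i + 1) (h : (σ.erase a).card = n) :
    X (toLex (i, a)) * initialMinor k (σ.erase a) h =
      ∏ b ∈ σ, xNat (if pos σ b ≤ i then pos σ b else pos σ b - 1) b := by
  rw [initialMinor_eq_prod, ← Finset.mul_prod_erase σ _ ha]
  congr 1
  · have : (if pos σ a ≤ i then pos σ a else pos σ a - 1) = i := by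
      split_ifs <;> omega
    rw [this, xNat, dif_pos i.2]
  · refine Finset.prod_congr rfl fun b hb => ?_
    rw [Finset.mem_erase] at hb
    have p1 := pos_erase ha b
    congr 1
    rcases lt_or_gt_of_ne hb.1 with hlt | hlt
    · have := pos_lt hb.2 hlt
      simp only [hlt.not_gt, if_false] at p1
      rw [if_pos] <;> omega
    · have := pos_lt ha hlt
      simp only [hlt, if_true] at p1
      split_ifs <;> omega

theorem sum_initialMinor (b : Idx n Δ 1) :
    ∑ q ∈ (indexSet b.1.1 b.1.2).attach, ((-1) ^ pos b.1.2 q.1.2 * X (toLex q.1) : Ring n m k) *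
      initialMinor k (b.remove q.1 q.2).1.2 (card_eq _) = 0 := by
  obtain ⟨⟨α, σ⟩, hσ, hcard, hα⟩ := b
  simp only at hcard hα
  have hex : ∃ i, 0 < α i := by
    by_contra! h
    have : ∑ l, α l = 0 := Finset.sum_eq_zero fun l _ => Nat.le_zero.1 (h l)
    omega
  obtain ⟨i, hi⟩ := hex
  have hαi : α = Pi.single i 1 := by
    have h1 := Finset.add_sum_erase Finset.univ α (Finset.mem_univ i)
    have h0 : ∑ l ∈ Finset.univ.erase i, α l = 0 := by omega
    rw [Finset.sum_eq_zero_iff] at h0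
    ext l
    by_cases hl : l = i
    · subst hl; simp; omega
    · simp [hl, h0 l (by simp [hl])]
  have hlo : ∑ l ∈ Finset.Iio i, α l = 0 := by
    rw [hαi]; simp [Pi.single_apply]
  have hhi : ∑ l ∈ Finset.Iic i, α l = 1 := by
    rw [hαi]; simp [Pi.single_apply]
  have hmem : ∀ q, q ∈ indexSet α σ ↔
      q.1 = i ∧ q.2 ∈ σ ∧ (pos σ q.2 = i ∨ pos σ q.2 = i + 1) := by
    rintro ⟨j, a⟩
    simp only [indexSet, Finset.mem_filter, Finset.mem_univ, true_and]
    constructor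
    · rintro ⟨hj, ha, h1, h2⟩
      have hji : j = i := by
        by_contra hne
        rw [hαi] at hj
        simp [hne] at hj
      subst hji
      rw [hlo] at h1
      rw [hhi] at h2
      exact ⟨rfl, ha, by omega⟩
    · rintro ⟨rfl, ha, h⟩
      rw [hlo, hhi]
      exact ⟨hi, ha, by omega, by omega⟩
  set s := σ.orderEmbOfFin hcard with hs
  have hset : indexSet α σ = {(i, s i.castSucc), (i, s i.succ)} := by
    ext ⟨j, a⟩
    rw [hmem]
    simp only [Finset.mem_insert, Finset.mem_singleton, Prod.mk.injEq]
    constructor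
    · rintro ⟨rfl, ha, h⟩
      have : a ∈ Set.range s := by
        rw [hs, Finset.range_orderEmbOfFin]; exact ha
      obtain ⟨t, rfl⟩ := this
      rw [hs, pos_orderEmbOfFin] at h
      rcases h with h | h
      · left; refine ⟨rfl, congrArg s (Fin.ext ?_)⟩; simpa using h
      · right; refine ⟨rfl, congrArg s (Fin.ext ?_)⟩; simpa using h
    · rintro (⟨rfl, rfl⟩ | ⟨rfl, rfl⟩)
      · refine ⟨rfl, Finset.orderEmbOfFin_mem _ _ _, Or.inl ?_⟩
        rw [hs, pos_orderEmbOfFin]; simp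
      · refine ⟨rfl, Finset.orderEmbOfFin_mem _ _ _, Or.inr ?_⟩
        rw [hs, pos_orderEmbOfFin]; simp
  have hterm : ∀ q : {x // x ∈ indexSet α σ},
      ((-1) ^ pos σ q.1.2 * X (toLex q.1) : Ring n m k) *
        initialMinor k (Idx.remove (Δ := Δ) (i := 0) ⟨(α, σ), hσ, hcard, hα⟩ q.1 q.2).1.2
          (card_eq _) =
      (-1) ^ pos σ q.1.2 * ∏ b ∈ σ, xNat (if pos σ b ≤ i then pos σ b else pos σ b - 1) b := by
    rintro ⟨⟨j, a⟩, hq⟩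
    obtain ⟨h1, h2, h3⟩ := (hmem _).1 hq
    simp only at h1 h2 h3
    subst h1
    rw [mul_assoc]
    congr 1
    exact mul_initialMinor h2 h3 _
  rw [Finset.sum_congr rfl fun q _ => hterm q]
  rw [Finset.sum_attach (indexSet α σ) (fun q => (-1) ^ pos σ q.2 *
    ∏ b ∈ σ, (xNat (if pos σ b ≤ i then pos σ b else pos σ b - 1) b : Ring n m k)), hset,
    Finset.sum_pair]
  · simp only [hs, pos_orderEmbOfFin, Fin.val_castSucc, Fin.val_succ, pow_succ]
    ring
  · simp [Fin.ext_iff]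

theorem diff_diff_zero :
    (diff 0 ∘ₗ diff 1 : (Basis n Δ 2 →₀ Ring n m k) →ₗ[Ring n m k] _) = 0 := by
  refine Finsupp.lhom_ext fun b r => ?_
  rw [LinearMap.comp_apply, diff_single, map_smul]
  have : diff 0 (dBasis 1 b) = (0 : Basis n Δ 0 →₀ Ring n m k) := by
    refine (map_sum (diff 0) _ _).trans ?_
    refine Eq.trans (b := Finsupp.single () (∑ q ∈ (indexSet b.1.1 b.1.2).attach,
      ((-1) ^ pos b.1.2 q.1.2 * X (toLex q.1) : Ring n m k) *
        initialMinor k (Idx.remove (i := 0) b q.1 q.2).1.2 (card_eq _))) ?_ ?_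
    · rw [Finsupp.single_finsetSum]
      refine Finset.sum_congr rfl fun q _ => ?_
      refine (diff_single 0 _ _).trans ?_
      exact Finsupp.smul_single _ _ _
    · exact (congrArg (Finsupp.single ()) (sum_initialMinor b)).trans (Finsupp.single_zero _)
  rw [this, smul_zero, LinearMap.zero_apply]

theorem finite_Idx (i : ℕ) : Finite (Idx n Δ i) := by
  have : Finite {α : Fin n → ℕ // ∑ l, α l = i} := by
    refine Set.Finite.subset (Set.finite_Iic (fun _ : Fin n => i)) fun α hα l => ?_
    have hα' : ∑ l, α l = i := hα
    rw [← hα']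
    exact Finset.single_le_sum (f := α) (fun _ _ => Nat.zero_le _) (Finset.mem_univ l)
  refine Finite.of_injective (β := {α : Fin n → ℕ // ∑ l, α l = i} × Finset (Fin m))
    (fun b => (⟨b.1.1, b.2.2.2⟩, b.1.2)) ?_
  intro b c h
  simp only [Prod.mk.injEq, Subtype.mk.injEq] at h
  exact Subtype.ext (Prod.ext h.1 h.2)

theorem homogeneous_dIdx {i : ℕ} (b : Idx n Δ (i + 1)) (c : Idx n Δ i) (s : Vars n m →₀ ℕ)
    (h : ((dIdx b : Idx n Δ i →₀ Ring n m k) c).coeff s ≠ 0) : s.degree = 1 := by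
  have hh : ((dIdx b : Idx n Δ i →₀ Ring n m k) c).IsHomogeneous 1 := by
    rw [dIdx, Finsupp.finsetSum_apply]
    refine IsHomogeneous.sum _ _ _ fun q _ => ?_
    rw [Finsupp.single_apply]
    split_ifs
    · refine IsHomogeneous.mul (m := 0) (n := 1) ?_ (isHomogeneous_X _ _)
      have : ((-1) ^ pos b.1.2 q.1.2 : Ring n m k) = C ((-1) ^ pos b.1.2 q.1.2) := by simp
      rw [this]
      exact isHomogeneous_C _ _
    · exact isHomogeneous_zero _ _ _
  rw [Finsupp.degree_eq_weight_one]
  exact hh h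

theorem homogeneous_initialMinor (σ : Finset (Fin m)) (hσ : σ.card = n) (s : Vars n m →₀ ℕ)
    (h : (initialMinor k σ hσ).coeff s ≠ 0) : s.degree = n := by
  have hh : (initialMinor k σ hσ).IsHomogeneous n := by
    rw [initialMinor_eq]
    have := IsHomogeneous.prod Finset.univ
      (fun i => (X (toLex (i, σ.orderEmbOfFin hσ i)) : Ring n m k)) (fun _ => 1)
      fun i _ => isHomogeneous_X _ _
    simpa using this
  rw [Finsupp.degree_eq_weight_one]
  exact hh h

variable (n Δ k) in
/-- The generalized sparse Eagon-Northcott complex of a simplicial complex `Δ` on `m` vertices and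
the generic `n × m` matrix over `k`. -/
def sparseENComplex : GradedFreeComplex (Vars n m) k where
  B := Basis n Δ
  finite_B
    | 0 => inferInstanceAs (Finite Unit)
    | i + 1 => finite_Idx i
  deg := degree n Δ
  d := diff
  homogeneous_d
    | 0, b, c, s, h => by
      rw [diff_single, one_smul] at h
      have : s.degree = n := by
        refine homogeneous_initialMinor (k := k) b.1.2 (card_eq b) s ?_
        have hc : c = () := rfl
        rw [hc] at h
        simpa [dBasis] using h
      simp [degree, this]
    | i + 1, b, c, s, h => by
      rw [diff_single, one_smul] at h
      have : s.degree = 1 := homogeneous_dIdx (k := k) b c s h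
      simp only [degree, this]
      omega
  d_comp_d
    | 0 => diff_diff_zero
    | i + 1 => diff_diff_succ i

end SparseEN

end

/-! The module is `N = im d₁`, the ideal generated by the initial terms of the minors on the faces
with `n` elements. Both claims follow from `IsLinearlyExact`: with the basis of `𝒞_{i+1}` in degree
`n + i`, a cycle of internal degree `n + i` is zero and a cycle of degree `n + i + 1` is a boundary.

Combinatorics: cut `σ` into consecutive blocks of sizes `α_l + 1`. Then `(α, σ)` amounts to a set of
cells `(l, a)` of the matrix, increasing from row to row, with every row occupied and no column used
twice. The differentials after `d₁` delete a cell `q` from a row with at least two cells, with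
coefficient `± x_q` (`cells_erase`, `diff_succ_apply`), and `d₁` multiplies the variables of all
cells. For a cycle with linear entries, let `c S x` be the coefficient of the variable `x` at the
basis element `S`. The cycle bounds a vector of constants as soon as `c S x = 0` whenever `x` cannot
be added to `S`, and the signed values `c (b - x) x` agree for all removable cells `x` of `b`
(`exists_weight`, `exists_diff_eq`). Both conditions come from comparing coefficients of monomials
in the cycle equation. The hypothesis on 1-nonfaces is needed for the first when `x` fits the blocks
of `S` but `σ ∪ {x}` is not a face: then two consecutive elements of `σ ∪ {x}` cannot both have a
face as complement (`IsLinearCycle.eq_zero`, `coeff_eq_zero_of_diff_zero`).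

Homological algebra: a minimal resolution of `N` is built around `𝒞` (`Stage.exists_next`). At each
stage the images of the basis of `𝒞` are a minimal generating set of the syzygies in their lowest
degree, by linear exactness, and they are completed by generators of larger degree
(`exists_minimal_generators`). The added generators miss the linear strand, which is therefore `𝒞`.
-/

noncomputable section

namespace SparseEN

variable {n m : ℕ} {k : Type u} [Field k]

/-! ### The rows of a basis element -/

/-- The pairs `(l, a)` for which `a` lies in the `l`-th block of `σ`, where `σ` is cut into
consecutive blocks of sizes `α_l + 1`. -/
def cells (α : Fin n → ℕ) (σ : Finset (Fin m)) : Finset (Fin n × Fin m) :=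
  Finset.univ.filter fun q => q.2 ∈ σ ∧
    q.1 + ∑ l ∈ Finset.Iio q.1, α l ≤ pos σ q.2 ∧ pos σ q.2 ≤ q.1 + ∑ l ∈ Finset.Iic q.1, α l

theorem mem_cells {α : Fin n → ℕ} {σ : Finset (Fin m)} {q : Fin n × Fin m} :
    q ∈ cells α σ ↔ q.2 ∈ σ ∧ q.1 + ∑ l ∈ Finset.Iio q.1, α l ≤ pos σ q.2 ∧
      pos σ q.2 ≤ q.1 + ∑ l ∈ Finset.Iic q.1, α l := by
  simp [cells]

theorem mem_indexSet {α : Fin n → ℕ} {σ : Finset (Fin m)} {q : Fin n × Fin m} :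
    q ∈ indexSet α σ ↔ 0 < α q.1 ∧ q ∈ cells α σ := by
  simp [cells, indexSet]

theorem sum_Iic_eq (α : Fin n → ℕ) (l : Fin n) :
    ∑ i ∈ Finset.Iic l, α i = ∑ i ∈ Finset.Iio l, α i + α l := by
  rw [← Finset.Iio_insert, Finset.sum_insert (by simp), add_comm]

theorem sum_Iic_le_sum_Iio (α : Fin n → ℕ) {l l' : Fin n} (h : l < l') :
    ∑ i ∈ Finset.Iic l, α i ≤ ∑ i ∈ Finset.Iio l', α i := by
  apply Finset.sum_le_sum_of_subset
  intro i hi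
  simp only [Finset.mem_Iic, Finset.mem_Iio] at hi ⊢
  exact lt_of_le_of_lt hi h

theorem pos_lt_card {σ : Finset (Fin m)} {a : Fin m} (ha : a ∈ σ) : pos σ a < σ.card := by
  apply Finset.card_lt_card
  rw [Finset.ssubset_iff_of_subset (Finset.filter_subset _ _)]
  exact ⟨a, ha, by simp⟩

theorem lt_of_pos_lt {σ : Finset (Fin m)} {a b : Fin m} (h : pos σ a < pos σ b) : a < b := by
  by_contra! hba
  refine absurd h (not_lt.2 (Finset.card_le_card fun c hc => ?_))
  simp only [Finset.mem_filter] at hc ⊢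
  exact ⟨hc.1, hc.2.trans_le hba⟩

theorem pos_injOn {σ : Finset (Fin m)} {a b : Fin m} (ha : a ∈ σ) (hb : b ∈ σ)
    (h : pos σ a = pos σ b) : a = b := by
  rcases lt_trichotomy a b with hab | hab | hab
  · exact absurd h (pos_lt ha hab).ne
  · exact hab
  · exact absurd h (pos_lt hb hab).ne'

theorem exists_pos_eq {σ : Finset (Fin m)} {p : ℕ} (hp : p < σ.card) :
    ∃ a ∈ σ, pos σ a = p :=
  ⟨σ.orderEmbOfFin rfl ⟨p, hp⟩, Finset.orderEmbOfFin_mem _ _ _, pos_orderEmbOfFin σ rfl _⟩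

theorem pos_insert_self (σ : Finset (Fin m)) (a : Fin m) : pos (insert a σ) a = pos σ a := by
  rw [pos, pos, Finset.filter_insert, if_neg (lt_irrefl a)]

theorem pos_erase_self (σ : Finset (Fin m)) (a : Fin m) : pos (σ.erase a) a = pos σ a := by
  rw [pos, pos, Finset.filter_erase, Finset.erase_eq_of_notMem (by simp)]

/-- Every position lies in some block. -/
theorem exists_row (α : Fin n → ℕ) {p : ℕ} (hp : p < n + ∑ l, α l) :
    ∃ l : Fin n, l + ∑ i ∈ Finset.Iio l, α i ≤ p ∧ p ≤ l + ∑ i ∈ Finset.Iic l, α i := by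
  have hn : 0 < n := by
    rcases Nat.eq_zero_or_pos n with rfl | h
    · simp at hp
    · exact h
  have hex : ∃ l : Fin n, p ≤ l + ∑ i ∈ Finset.Iic l, α i := by
    refine ⟨⟨n - 1, by omega⟩, ?_⟩
    have : Finset.Iic (⟨n - 1, by omega⟩ : Fin n) = Finset.univ := by
      ext i; simp [Fin.le_def]; omega
    rw [this]
    simp only
    omega
  -- Take the first row whose upper end reaches `p`. If its lower end exceeded `p`, the row before
  -- it would already reach `p`.
  obtain ⟨l, hl, hmin⟩ := WellFounded.has_min (wellFounded_lt (α := Fin n))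
    {l : Fin n | p ≤ l + ∑ i ∈ Finset.Iic l, α i} hex
  refine ⟨l, ?_, hl⟩
  rcases Nat.eq_zero_or_pos (l : ℕ) with h0 | h0
  · have : Finset.Iio l = ∅ := by
      ext i; simp [Fin.le_def, h0]
    simp [this, h0]
  · have hlt : (⟨l - 1, by omega⟩ : Fin n) < l := by
      rw [Fin.lt_def]; simp only; omega
    have h := hmin ⟨l - 1, by omega⟩
    have h2 : ¬ p ≤ (l - 1 : ℕ) + ∑ i ∈ Finset.Iic (⟨l - 1, by omega⟩ : Fin n), α i :=
      fun h' => h h' hlt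
    have h3 : Finset.Iio l = Finset.Iic (⟨l - 1, by omega⟩ : Fin n) := by
      ext i
      rw [Finset.mem_Iio, Finset.mem_Iic, Fin.lt_def, Fin.le_def]
      simp only
      omega
    rw [h3]
    omega

theorem row_lt_card {α : Fin n → ℕ} {σ : Finset (Fin m)} (h : σ.card = n + ∑ l, α l) (l : Fin n) :
    l + ∑ i ∈ Finset.Iic l, α i < σ.card := by
  have : ∑ i ∈ Finset.Iic l, α i ≤ ∑ i, α i :=
    Finset.sum_le_sum_of_subset (Finset.subset_univ _)
  omega

theorem exists_mem_cells_of_mem {α : Fin n → ℕ} {σ : Finset (Fin m)}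
    (h : σ.card = n + ∑ l, α l) {a : Fin m} (ha : a ∈ σ) : ∃ l, (l, a) ∈ cells α σ := by
  obtain ⟨l, h1, h2⟩ := exists_row α (h ▸ pos_lt_card ha)
  exact ⟨l, mem_cells.2 ⟨ha, h1, h2⟩⟩

theorem exists_mem_cells_row {α : Fin n → ℕ} {σ : Finset (Fin m)}
    (h : σ.card = n + ∑ l, α l) (l : Fin n) : ∃ a, (l, a) ∈ cells α σ := by
  obtain ⟨a, ha, hp⟩ := exists_pos_eq (row_lt_card h l)
  refine ⟨a, mem_cells.2 ⟨ha, ?_, hp.le⟩⟩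
  simp only [hp, sum_Iic_eq]
  omega

/-- A block with at least two elements contains two consecutive elements. -/
theorem exists_pair_mem_cells {α : Fin n → ℕ} {σ : Finset (Fin m)}
    (h : σ.card = n + ∑ l, α l) {l : Fin n} (hl : 0 < α l) :
    ∃ a b, (l, a) ∈ cells α σ ∧ (l, b) ∈ cells α σ ∧ pos σ b = pos σ a + 1 := by
  have hc := row_lt_card h l
  -- The last two positions of the block are used; `α l > 0` keeps the earlier one inside it.
  obtain ⟨b, hb, hpb⟩ := exists_pos_eq hc
  obtain ⟨a, ha, hpa⟩ := exists_pos_eq (σ := σ) (p := l + ∑ i ∈ Finset.Iic l, α i - 1) (by omega)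
  rw [sum_Iic_eq] at hpa hpb
  refine ⟨a, b, mem_cells.2 ⟨ha, ?_, ?_⟩, mem_cells.2 ⟨hb, ?_, ?_⟩, ?_⟩ <;>
    (try simp only [sum_Iic_eq]) <;> omega

/-- In a block with at least two elements, every element has a neighbour. -/
theorem exists_neighbour_mem_cells {α : Fin n → ℕ} {σ : Finset (Fin m)}
    (h : σ.card = n + ∑ l, α l) {x : Fin n × Fin m} (hx : x ∈ cells α σ) (hl : 0 < α x.1) :
    ∃ b, (x.1, b) ∈ cells α σ ∧ (pos σ b = pos σ x.2 + 1 ∨ pos σ x.2 = pos σ b + 1) := by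
  have hc := row_lt_card h x.1
  obtain ⟨hx2, h1, h2⟩ := mem_cells.1 hx
  rw [sum_Iic_eq] at h2 hc
  by_cases he : pos σ x.2 = x.1 + (∑ i ∈ Finset.Iio x.1, α i + α x.1)
  · obtain ⟨b, hb, hpb⟩ := exists_pos_eq (σ := σ) (p := pos σ x.2 - 1) (by omega)
    refine ⟨b, mem_cells.2 ⟨hb, ?_, ?_⟩, ?_⟩ <;>
      (try simp only [sum_Iic_eq]) <;> omega
  · obtain ⟨b, hb, hpb⟩ := exists_pos_eq (σ := σ) (p := pos σ x.2 + 1) (by omega)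
    refine ⟨b, mem_cells.2 ⟨hb, ?_, ?_⟩, ?_⟩ <;>
      (try simp only [sum_Iic_eq]) <;> omega

/-- The blocks are increasing. -/
theorem cells_ordered {α : Fin n → ℕ} {σ : Finset (Fin m)} {q r : Fin n × Fin m}
    (hq : q ∈ cells α σ) (hr : r ∈ cells α σ) (h : q.1 < r.1) : q.2 < r.2 := by
  obtain ⟨-, -, h1⟩ := mem_cells.1 hq
  obtain ⟨-, h2, -⟩ := mem_cells.1 hr
  have h3 := sum_Iic_le_sum_Iio α h
  have h4 : (q.1 : ℕ) < r.1 := h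
  exact lt_of_pos_lt (σ := σ) (by omega)

theorem cells_eq_of_snd_eq {α : Fin n → ℕ} {σ : Finset (Fin m)} {q r : Fin n × Fin m}
    (hq : q ∈ cells α σ) (hr : r ∈ cells α σ) (h : q.2 = r.2) : q = r := by
  rcases lt_trichotomy q.1 r.1 with h' | h' | h'
  · exact absurd h (cells_ordered hq hr h').ne
  · exact Prod.ext h' h
  · exact absurd h (cells_ordered hr hq h').ne'

/-- A block with `α_l = 0` has only one element. -/
theorem cells_eq_of_fst_eq {α : Fin n → ℕ} {σ : Finset (Fin m)} {q r : Fin n × Fin m}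
    (hq : q ∈ cells α σ) (hr : r ∈ cells α σ) (h : q.1 = r.1) (h0 : α q.1 = 0) : q = r := by
  refine Prod.ext h ?_
  obtain ⟨l, a⟩ := q
  obtain ⟨l', b⟩ := r
  simp only at h h0
  subst h
  obtain ⟨hq2, h1, h1'⟩ := mem_cells.1 hq
  obtain ⟨hr2, h2, h2'⟩ := mem_cells.1 hr
  rw [sum_Iic_eq] at h1' h2'
  simp only at *
  exact pos_injOn hq2 hr2 (by omega)

/-- Deleting `q` shortens its block by one and shifts later blocks and later positions together, so
no other element changes row. Hence the differential is deletion of cells. -/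
theorem cells_erase {α : Fin n → ℕ} {σ : Finset (Fin m)} {q : Fin n × Fin m}
    (hq : q ∈ indexSet α σ) :
    cells (α - Pi.single q.1 1) (σ.erase q.2) = (cells α σ).erase q := by
  obtain ⟨i, a⟩ := q
  ext ⟨j, b⟩
  obtain ⟨hi, hq⟩ := mem_indexSet.1 hq
  obtain ⟨ha, h1, h2⟩ := mem_cells.1 hq
  simp only [mem_cells, Finset.mem_erase, ne_eq, Prod.mk.injEq, not_and] at *
  have e1 := sum_sub_single α i hi (Finset.Iio j)
  have e2 := sum_sub_single α i hi (Finset.Iic j)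
  have p1 := pos_erase ha b
  simp only [Finset.mem_Iio, Finset.mem_Iic] at e1 e2
  by_cases hb : b ∈ σ
  swap
  · simp [hb]
  by_cases hba : b = a
  · subst hba
    simp only [not_true_eq_false, false_and, false_iff, not_and, imp_false]
    intro hne _ h3
    rcases lt_trichotomy j i with hij | hij | hij
    · have hm := sum_Iic_le_sum_Iio α hij
      have hv : (j : ℕ) < i := hij
      omega
    · exact absurd hij hne
    · have hm := sum_Iic_le_sum_Iio α hij
      have hv : (i : ℕ) < j := hij
      omega
  have hab : a < b → pos σ a < pos σ b := pos_lt ha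
  have hba' : b < a → pos σ b < pos σ a := pos_lt hb
  have hne : a < b ∨ b < a := lt_or_gt_of_ne (Ne.symm hba)
  simp only [hba, hb, true_and, not_false_eq_true, implies_true]
  rcases lt_trichotomy i j with hij | hij | hij
  · have hm := sum_Iic_le_sum_Iio α hij
    have hv : (i : ℕ) < j := hij
    simp only [hij, hij.le, if_true] at e1 e2
    rcases hne with h | h
    · have := hab h
      simp only [h, if_true] at p1
      omega
    · have := hba' h
      simp only [h.not_gt, if_false] at p1
      omega
  · subst hij
    simp only [lt_irrefl, le_refl, if_true, if_false] at e1 e2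
    rcases hne with h | h
    · have := hab h
      simp only [h, if_true] at p1
      omega
    · have := hba' h
      simp only [h.not_gt, if_false] at p1
      omega
  · have hm := sum_Iic_le_sum_Iio α hij
    have hv : (j : ℕ) < i := hij
    simp only [hij.not_gt, hij.not_ge, if_false] at e1 e2
    rcases hne with h | h
    · have := hab h
      simp only [h, if_true] at p1
      omega
    · have := hba' h
      simp only [h.not_gt, if_false] at p1
      omega

theorem add_single_tsub (α : Fin n → ℕ) (l : Fin n) :
    (α + Pi.single l 1 - Pi.single l 1 : Fin n → ℕ) = α := by
  ext i; simp

/-- A cell that is compatible with all the blocks can be added. -/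
theorem mem_indexSet_insert {α : Fin n → ℕ} {σ : Finset (Fin m)} (h : σ.card = n + ∑ l, α l)
    {x : Fin n × Fin m} (hx : x ∉ cells α σ)
    (h1 : ∀ q ∈ cells α σ, q.1 < x.1 → q.2 < x.2) (h2 : ∀ q ∈ cells α σ, x.1 < q.1 → x.2 < q.2) :
    x.2 ∉ σ ∧ x ∈ indexSet (α + Pi.single x.1 1) (insert x.2 σ) := by
  obtain ⟨l, a⟩ := x
  simp only at h1 h2 ⊢
  have ha : a ∉ σ := by
    intro ha
    obtain ⟨l', hl'⟩ := exists_mem_cells_of_mem h ha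
    rcases lt_trichotomy l' l with hlt | rfl | hlt
    · exact lt_irrefl _ (h1 _ hl' hlt)
    · exact hx hl'
    · exact lt_irrefl _ (h2 _ hl' hlt)
  refine ⟨ha, mem_indexSet.2 ⟨by simp, mem_cells.2 ⟨by simp, ?_, ?_⟩⟩⟩
  · simp only [pos_insert_self]
    have e : ∑ i ∈ Finset.Iio l, (α + Pi.single l 1 : Fin n → ℕ) i = ∑ i ∈ Finset.Iio l, α i := by
      refine Finset.sum_congr rfl fun i hi => ?_
      simp [(Finset.mem_Iio.1 hi).ne]
    rw [e]
    by_contra! hlt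
    have hc := row_lt_card h l
    rw [sum_Iic_eq] at hc
    -- The last element before block `l` lies in an earlier row, so it is left of `a`, and `a`
    -- cannot be positioned before the block. The upper bound is symmetric, with the first element
    -- after the block.
    obtain ⟨c, hc, hpc⟩ := exists_pos_eq (σ := σ)
      (p := l + ∑ i ∈ Finset.Iio l, α i - 1) (by omega)
    obtain ⟨l', hl'⟩ := exists_mem_cells_of_mem h hc
    have hll : l' < l := by
      by_contra! hle
      have h3 := (mem_cells.1 hl').2.1
      simp only [hpc] at h3
      have hv : (l : ℕ) ≤ l' := hle
      have : ∑ i ∈ Finset.Iio l, α i ≤ ∑ i ∈ Finset.Iio l', α i :=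
        Finset.sum_le_sum_of_subset (Finset.Iio_subset_Iio hle)
      omega
    have := pos_lt hc (h1 _ hl' hll)
    omega
  · simp only [pos_insert_self]
    have e : ∑ i ∈ Finset.Iic l, (α + Pi.single l 1 : Fin n → ℕ) i =
        ∑ i ∈ Finset.Iic l, α i + 1 := by
      simp [Finset.sum_add_distrib, Pi.single_apply]
    rw [e]
    by_contra! hlt
    have hle : pos σ a ≤ σ.card := Finset.card_le_card (Finset.filter_subset _ _)
    obtain ⟨c, hc, hpc⟩ := exists_pos_eq (σ := σ)
      (p := l + ∑ i ∈ Finset.Iic l, α i + 1) (by omega)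
    obtain ⟨l', hl'⟩ := exists_mem_cells_of_mem h hc
    have hll : l < l' := by
      by_contra! hle
      have h3 := (mem_cells.1 hl').2.2
      simp only [hpc] at h3
      have hv : (l' : ℕ) ≤ l := hle
      have : ∑ i ∈ Finset.Iic l', α i ≤ ∑ i ∈ Finset.Iic l, α i :=
        Finset.sum_le_sum_of_subset (Finset.Iic_subset_Iic.2 hle)
      omega
    have hac := h2 _ hl' hll
    have : pos σ a ≤ pos σ c := by
      refine Finset.card_le_card fun d hd => ?_
      simp only [Finset.mem_filter] at hd ⊢
      exact ⟨hd.1, hd.2.trans hac⟩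
    omega

/-- Two consecutive elements of a nonface whose removal gives faces make it a `1`-nonface. -/
theorem isNonface_one {Δ : PreAbstractSimplicialComplex (Fin m)} {σ : Finset (Fin m)}
    (hσ : σ ∉ Δ) {a b : Fin m} (ha : a ∈ σ) (hb : b ∈ σ) (hab : pos σ b = pos σ a + 1)
    (h1 : σ.erase a ∈ Δ) (h2 : σ.erase b ∈ Δ) : IsNonface Δ 1 σ := by
  have hlt : pos σ a + 1 < σ.card := hab ▸ pos_lt_card hb
  have key : ∀ c ∈ σ, ∀ p (hp : p < σ.card), pos σ c = p → σ.orderEmbOfFin rfl ⟨p, hp⟩ = c := by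
    intro c hc p hp he
    exact pos_injOn (Finset.orderEmbOfFin_mem _ _ _) hc
      ((pos_orderEmbOfFin σ rfl ⟨p, hp⟩).trans he.symm)
  refine ⟨hσ, pos σ a, hlt, fun l hl => ?_⟩
  obtain rfl | rfl : l = 0 ∨ l = 1 := by omega
  · rwa [key a ha _ _ (by simp)]
  · rwa [key b hb _ _ hab]

end SparseEN

/-! ### Adding and removing cells, and the differential in these terms -/

namespace SparseEN

variable {n m : ℕ} {k : Type u} [Field k] {Δ : PreAbstractSimplicialComplex (Fin m)}

theorem Idx.card_eq_add_sum {i : ℕ} (b : Idx n Δ i) : b.1.2.card = n + ∑ l, b.1.1 l := by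
  rw [b.2.2.1, b.2.2.2]

/-- The cells of a basis element. -/
abbrev Idx.cells {i : ℕ} (b : Idx n Δ i) : Finset (Fin n × Fin m) :=
  SparseEN.cells b.1.1 b.1.2

/-- The cells that may be removed from a basis element. -/
abbrev Idx.removable {i : ℕ} (b : Idx n Δ i) : Finset (Fin n × Fin m) :=
  indexSet b.1.1 b.1.2

/-- The cell `q` can be added to the basis element `T`. -/
def Idx.Addable {i : ℕ} (T : Idx n Δ i) (q : Fin n × Fin m) : Prop :=
  q.2 ∉ T.1.2 ∧ insert q.2 T.1.2 ∈ Δ ∧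
    q ∈ indexSet (T.1.1 + Pi.single q.1 1) (insert q.2 T.1.2)

/-- The index `(α + ε_l, σ ∪ {a})`. -/
def Idx.addCell {i : ℕ} (T : Idx n Δ i) (q : Fin n × Fin m) (h : T.Addable q) : Idx n Δ (i + 1) :=
  ⟨(T.1.1 + Pi.single q.1 1, insert q.2 T.1.2), h.2.1, by
    rw [Finset.card_insert_of_notMem h.1, T.2.2.1, add_assoc], by
    simp [Finset.sum_add_distrib, T.2.2.2, Pi.single_apply]⟩

theorem Idx.mem_removable_addCell {i : ℕ} (T : Idx n Δ i) {q : Fin n × Fin m} (h : T.Addable q) :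
    q ∈ (T.addCell q h).removable := h.2.2

theorem Idx.addCell_remove {i : ℕ} (T : Idx n Δ i) {q : Fin n × Fin m} (h : T.Addable q) :
    (T.addCell q h).remove q (T.mem_removable_addCell h) = T := by
  apply Subtype.ext
  refine Prod.ext ?_ ?_
  · exact add_single_tsub _ _
  · exact Finset.erase_insert h.1

theorem Idx.single_sub_add {i : ℕ} (b : Idx n Δ (i + 1)) {q : Fin n × Fin m}
    (hq : q ∈ b.removable) :
    ((b.remove q hq).1.1 + Pi.single q.1 1, insert q.2 (b.remove q hq).1.2) = b.1 := by
  obtain ⟨h1, h2⟩ := mem_indexSet.1 hq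
  refine Prod.ext ?_ (Finset.insert_erase (mem_cells.1 h2).1)
  funext l
  by_cases hl : l = q.1
  · subst hl
    simp [Idx.remove]
    omega
  · simp [Idx.remove, hl]

theorem Idx.addable_remove {i : ℕ} (b : Idx n Δ (i + 1)) {q : Fin n × Fin m}
    (hq : q ∈ b.removable) : (b.remove q hq).Addable q := by
  have h := b.single_sub_add hq
  have h1 := congrArg Prod.fst h
  have h2 := congrArg Prod.snd h
  simp only at h1 h2
  refine ⟨Finset.notMem_erase _ _, ?_, ?_⟩
  · rw [h2]; exact b.2.1
  · rw [h1, h2]; exact hq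

theorem Idx.remove_addCell {i : ℕ} (b : Idx n Δ (i + 1)) {q : Fin n × Fin m}
    (hq : q ∈ b.removable) : (b.remove q hq).addCell q (b.addable_remove hq) = b :=
  Subtype.ext (b.single_sub_add hq)

theorem Idx.cells_remove {i : ℕ} (b : Idx n Δ (i + 1)) {q : Fin n × Fin m}
    (hq : q ∈ b.removable) : (b.remove q hq).cells = b.cells.erase q :=
  cells_erase hq

theorem Idx.cells_addCell {i : ℕ} (T : Idx n Δ i) {q : Fin n × Fin m} (h : T.Addable q) :
    (T.addCell q h).cells = insert q T.cells := by
  have h1 := Idx.cells_remove _ (T.mem_removable_addCell h)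
  rw [T.addCell_remove h] at h1
  rw [h1, Finset.insert_erase (mem_indexSet.1 (T.mem_removable_addCell h)).2]

theorem Idx.exists_pos {i : ℕ} (b : Idx n Δ (i + 1)) :
    ∃ l, 0 < b.1.1 l := by
  by_contra! h
  have h0 : ∑ l, b.1.1 l = 0 := Finset.sum_eq_zero fun l _ => Nat.le_zero.1 (h l)
  have := b.2.2.2
  omega

open Classical in
/-- The coefficient of the differential at a basis element, as a sum over the cells that can be
added to it. -/
theorem diff_succ_apply {i : ℕ} (v : Idx n Δ (i + 1) →₀ Ring n m k) (T : Idx n Δ i) :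
    (diff (i + 1) v : Idx n Δ i →₀ Ring n m k) T = ∑ q : Fin n × Fin m,
      if h : T.Addable q then (-1) ^ pos T.1.2 q.2 * X (toLex q) * v (T.addCell q h) else 0 := by
  induction v using Finsupp.induction_linear with
  | zero =>
    rw [map_zero]
    simp
  | add v w hv hw =>
    rw [map_add]
    refine (congrArg₂ (· + ·) hv hw).trans ?_
    rw [← Finset.sum_add_distrib]
    refine Finset.sum_congr rfl fun q _ => ?_
    split_ifs
    · rw [Finsupp.add_apply, mul_add]
    · simp
  | single b r =>
    have h1 : (diff (i + 1) (Finsupp.single b r) : Idx n Δ i →₀ Ring n m k) = r • dIdx b :=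
      diff_single (i + 1) b r
    rw [h1, Finsupp.smul_apply, dIdx, Finsupp.finsetSum_apply, smul_eq_mul, Finset.mul_sum]
    -- For one basis vector `b`, the cells with `T + q = b` are those with `b - q = T`; the signs
    -- match because `q.2` has the same position in `T` and in `T + q`.
    have h2 : ∀ q : Fin n × Fin m, (if h : T.Addable q then
        (-1) ^ pos T.1.2 q.2 * X (toLex q) * (Finsupp.single b r) (T.addCell q h) else 0 :
          Ring n m k) = if h : q ∈ b.removable then
        r * (Finsupp.single (b.remove q h) ((-1) ^ pos b.1.2 q.2 * X (toLex q))) T else 0 := by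
      intro q
      by_cases hT : T.Addable q
      · rw [dif_pos hT]
        by_cases hb : b = T.addCell q hT
        · subst hb
          rw [dif_pos (T.mem_removable_addCell hT), T.addCell_remove hT]
          simp only [Finsupp.single_eq_same]
          rw [show (T.addCell q hT).1.2 = insert q.2 T.1.2 from rfl, pos_insert_self]
          ring
        · rw [Finsupp.single_apply, if_neg hb, mul_zero]
          split_ifs with hq
          · rw [Finsupp.single_apply, if_neg, mul_zero]
            rintro rfl
            exact hb (b.remove_addCell hq).symm
          · rfl
      · rw [dif_neg hT]
        split_ifs with hq
        · rw [Finsupp.single_apply, if_neg, mul_zero]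
          rintro rfl
          exact hT (b.addable_remove hq)
        · rfl
    rw [Finset.sum_congr rfl fun q _ => h2 q]
    rw [Finset.sum_dite, Finset.sum_const_zero, add_zero]
    refine Finset.sum_bij (fun q _ => ⟨q.1, by simp [q.2]⟩) ?_ ?_ ?_ ?_
    · intro q _; simp
    · intro q _ q' _ h
      exact Subtype.ext (congrArg (fun z => z.1) h)
    · rintro ⟨q, hq⟩ _
      exact ⟨⟨q, by simpa using hq⟩, by simp, rfl⟩
    · intro q _; rfl

end SparseEN

/-! ### Linear cycles in homological degree at least two -/

namespace SparseEN

variable {n m : ℕ} {k : Type u} [Field k] {Δ : PreAbstractSimplicialComplex (Fin m)}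

theorem Idx.mem_removable_of_pos {i : ℕ} (b : Idx n Δ i) {q : Fin n × Fin m} (hq : q ∈ b.cells)
    (h : 0 < b.1.1 q.1) : q ∈ b.removable := mem_indexSet.2 ⟨h, hq⟩

theorem Idx.mem_cells_of_mem_removable {i : ℕ} {b : Idx n Δ i} {q : Fin n × Fin m}
    (hq : q ∈ b.removable) : q ∈ b.cells := (mem_indexSet.1 hq).2

theorem Idx.mem_removable_remove {i : ℕ} (b : Idx n Δ (i + 1)) {x z : Fin n × Fin m}
    (hx : x ∈ b.removable) (hz : z ∈ b.removable) (h : z.1 ≠ x.1) :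
    z ∈ (b.remove x hx).removable := by
  refine Idx.mem_removable_of_pos _ ?_ ?_
  · rw [b.cells_remove hx, Finset.mem_erase]
    exact ⟨fun e => h (congrArg Prod.fst e), Idx.mem_cells_of_mem_removable hz⟩
  · simpa [Idx.remove, h] using (mem_indexSet.1 hz).1

/-- The cells of a basis element after adding a compatible cell, whether or not the new vertex set
is a face. -/
theorem cells_insert {α : Fin n → ℕ} {σ : Finset (Fin m)} {x : Fin n × Fin m} (hx : x.2 ∉ σ)
    (h : x ∈ indexSet (α + Pi.single x.1 1) (insert x.2 σ)) :
    cells (α + Pi.single x.1 1) (insert x.2 σ) = insert x (cells α σ) := by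
  have h1 := cells_erase h
  rw [add_single_tsub, Finset.erase_insert hx] at h1
  rw [h1, Finset.insert_erase (mem_indexSet.1 h).2]

theorem card_insert_eq {α : Fin n → ℕ} {σ : Finset (Fin m)} (h : σ.card = n + ∑ l, α l)
    {x : Fin n × Fin m} (hx : x.2 ∉ σ) :
    (insert x.2 σ).card = n + ∑ l, (α + Pi.single x.1 1 : Fin n → ℕ) l := by
  rw [Finset.card_insert_of_notMem hx, h]
  simp [Finset.sum_add_distrib, Pi.single_apply, add_assoc]

/-- The relations between the coefficients of a cycle that has degree one more than the generators,
in homological degree at least two. -/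
structure IsLinearCycle {j : ℕ} (c : Idx n Δ (j + 1) → Fin n × Fin m → k) : Prop where
  diag : ∀ (T : Idx n Δ j) x (h : T.Addable x), c (T.addCell x h) x = 0
  zero : ∀ (T : Idx n Δ j) x y (h : T.Addable y), x ≠ y → ¬ T.Addable x → c (T.addCell y h) x = 0
  swap : ∀ (T : Idx n Δ j) x y (hx : T.Addable x) (hy : T.Addable y), x ≠ y →
    (-1) ^ pos T.1.2 x.2 * c (T.addCell x hx) y + (-1) ^ pos T.1.2 y.2 * c (T.addCell y hy) x = 0

namespace IsLinearCycle

variable {j : ℕ} {c : Idx n Δ (j + 1) → Fin n × Fin m → k}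

theorem eq_zero_of_remove (hc : IsLinearCycle c) {S : Idx n Δ (j + 1)} {x y : Fin n × Fin m}
    (hy : y ∈ S.removable) (hxy : x ≠ y) (h : ¬ (S.remove y hy).Addable x) : c S x = 0 := by
  have := hc.zero _ x y (S.addable_remove hy) hxy h
  rwa [S.remove_addCell hy] at this

/-- Apart from the case settled by `diag`, it suffices to find a removable `y ≠ x` such that `x`
cannot be added to `S - y`. If `x` lies in `S` or is out of order with a cell `q` of `S`, that
obstruction survives the removal of a suitable `y`. Otherwise only the face condition fails for `S +
x`, and the absence of 1-nonfaces supplies `y`. -/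
theorem eq_zero (hc : IsLinearCycle c)
    (hΔ : ∀ σ : Finset (Fin m), n + 1 ≤ σ.card → ¬ IsNonface Δ 1 σ)
    (S : Idx n Δ (j + 1)) (x : Fin n × Fin m) (hx : ¬ S.Addable x) : c S x = 0 := by
  have hS := S.card_eq_add_sum
  obtain ⟨l, hl⟩ := S.exists_pos
  obtain ⟨a, b, hla, hlb, hab⟩ := exists_pair_mem_cells hS hl
  have hra : (l, a) ∈ S.removable := S.mem_removable_of_pos hla hl
  have hrb : (l, b) ∈ S.removable := S.mem_removable_of_pos hlb hl
  by_cases hxS : x ∈ S.cells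
  · by_cases hxr : x ∈ S.removable
    · have := hc.diag _ x (S.addable_remove hxr)
      rwa [S.remove_addCell hxr] at this
    · have hne : x ≠ (l, a) := by rintro rfl; exact hxr hra
      refine hc.eq_zero_of_remove hra hne fun h => h.1 ?_
      have : x ∈ (S.remove _ hra).cells := by
        rw [S.cells_remove hra, Finset.mem_erase]; exact ⟨hne, hxS⟩
      exact (mem_cells.1 this).1
  by_cases hord : (∀ q ∈ S.cells, q.1 < x.1 → q.2 < x.2) ∧ (∀ q ∈ S.cells, x.1 < q.1 → x.2 < q.2)
  · obtain ⟨hxσ, hxi⟩ := mem_indexSet_insert hS hxS hord.1 hord.2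
    have hnot : insert x.2 S.1.2 ∉ Δ := fun h => hx ⟨hxσ, h, hxi⟩
    have hcard := card_insert_eq hS hxσ
    have hcells := cells_insert hxσ hxi
    have hnf := hΔ (insert x.2 S.1.2) (by
      rw [Finset.card_insert_of_notMem hxσ, S.2.2.1]; omega)
    have hex : (insert x.2 S.1.2).erase x.2 ∈ Δ := by
      rw [Finset.erase_insert hxσ]; exact S.2.1
    suffices ∃ y ∈ S.removable, (insert x.2 S.1.2).erase y.2 ∉ Δ by
      obtain ⟨y, hy, hyΔ⟩ := this
      have hyσ := (mem_cells.1 (Idx.mem_cells_of_mem_removable hy)).1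
      have hne : x.2 ≠ y.2 := fun e => hxσ (e ▸ hyσ)
      refine hc.eq_zero_of_remove hy (fun e => hne (congrArg Prod.snd e)) fun h => hyΔ ?_
      rw [Finset.erase_insert_of_ne hne]
      exact h.2.1
    -- The block of `x` in `S` may lose a cell, so `y` can be a neighbour of `x`: erasing `x` gives
    -- the face `σ`, hence erasing the neighbour does not give a face.
    by_cases hpos : 0 < S.1.1 x.1
    · obtain ⟨b, hb, hb'⟩ := exists_neighbour_mem_cells hcard
        (hcells ▸ Finset.mem_insert_self _ _) (by simp)
      have hbσ := (mem_cells.1 hb).1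
      rw [hcells, Finset.mem_insert] at hb
      have hb2 : (x.1, b) ∈ S.cells := by
        refine hb.resolve_left fun e => ?_
        have : b = x.2 := congrArg Prod.snd e
        rw [this] at hb'
        omega
      refine ⟨(x.1, b), S.mem_removable_of_pos hb2 hpos, fun hbΔ => ?_⟩
      rcases hb' with h | h
      · exact hnf (isNonface_one hnot (by simp) hbσ h hex hbΔ)
      · exact hnf (isNonface_one hnot hbσ (by simp) h hbΔ hex)
    -- The block of `x` in `S` is a single cell that cannot be removed. A consecutive pair is taken
    -- in another row `l` instead, and one of its two erasures is not a face.
    · have hlx : l ≠ x.1 := by rintro rfl; exact hpos hl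
      obtain ⟨a, b, hla, hlb, hab⟩ := exists_pair_mem_cells hcard (l := l) (by simp [hlx, hl])
      have haσ := (mem_cells.1 hla).1
      have hbσ := (mem_cells.1 hlb).1
      rw [hcells, Finset.mem_insert] at hla hlb
      have hla' := hla.resolve_left fun e => hlx (congrArg Prod.fst e)
      have hlb' := hlb.resolve_left fun e => hlx (congrArg Prod.fst e)
      by_contra! hcon
      exact hnf (isNonface_one hnot haσ hbσ hab (hcon _ (S.mem_removable_of_pos hla' hl))
        (hcon _ (S.mem_removable_of_pos hlb' hl)))
  · obtain ⟨q, hq, hviol⟩ : ∃ q ∈ S.cells,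
        ¬ ((q.1 < x.1 → q.2 < x.2) ∧ (x.1 < q.1 → x.2 < q.2)) := by
      by_contra! h
      exact hord ⟨fun q hq => (h q hq).1, fun q hq => (h q hq).2⟩
    -- Row `l` has two removable cells, so one can be removed while keeping the cell `q` that
    -- conflicts with `x`.
    obtain ⟨y, hy, hyq⟩ : ∃ y ∈ S.removable, y ≠ q := by
      by_cases h : (l, a) = q
      · refine ⟨(l, b), hrb, ?_⟩
        rintro rfl
        have : a = b := congrArg Prod.snd h
        rw [this] at hab
        omega
      · exact ⟨_, hra, h⟩
    have hxy : x ≠ y := by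
      rintro rfl; exact hxS (Idx.mem_cells_of_mem_removable hy)
    refine hc.eq_zero_of_remove hy hxy fun h => hviol ?_
    have hcells := Idx.cells_addCell _ h
    have hx' : x ∈ ((S.remove y hy).addCell x h).cells := by
      rw [hcells]; exact Finset.mem_insert_self _ _
    have hq' : q ∈ ((S.remove y hy).addCell x h).cells := by
      rw [hcells, S.cells_remove hy]
      exact Finset.mem_insert_of_mem (Finset.mem_erase.2 ⟨hyq.symm, hq⟩)
    exact ⟨cells_ordered hq' hx', cells_ordered hx' hq'⟩

/-- This is `swap` at `T = b - x - y`, where `T + x = b - y` and `T + y = b - x`. The signs are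
rearranged with `sign_swap`, since the two orders of deletion differ by a sign. -/
theorem eq_of_mem_removable_remove (hc : IsLinearCycle c) {b : Idx n Δ (j + 2)}
    {x y : Fin n × Fin m} (hx : x ∈ b.removable) (hy : y ∈ b.removable)
    (h : y ∈ (b.remove x hx).removable) :
    (-1) ^ pos b.1.2 x.2 * c (b.remove x hx) x = (-1) ^ pos b.1.2 y.2 * c (b.remove y hy) y := by
  have hyx : y ≠ x := by
    rintro rfl
    have := Idx.mem_cells_of_mem_removable h
    rw [b.cells_remove hx] at this
    simp at this
  have hx2 : x ∈ (b.remove y hy).removable := (indexSet_swap hx h).2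
  have hT : (b.remove x hx).remove y h = (b.remove y hy).remove x hx2 := by
    apply Subtype.ext
    simp only [Idx.remove]
    rw [Finset.erase_right_comm, tsub_right_comm]
  have h1 := (b.remove x hx).addable_remove h
  have h2 := (b.remove y hy).addable_remove hx2
  have e1 := (b.remove x hx).remove_addCell h
  have e2 := (b.remove y hy).remove_addCell hx2
  have p1 : pos ((b.remove x hx).remove y h).1.2 y.2 = pos (b.1.2.erase x.2) y.2 :=
    pos_erase_self _ _
  have p2 : pos ((b.remove y hy).remove x hx2).1.2 x.2 = pos (b.1.2.erase y.2) x.2 :=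
    pos_erase_self _ _
  have key := hc.swap ((b.remove x hx).remove y h) x y (hT ▸ h2) h1 hyx.symm
  have e2' : ((b.remove x hx).remove y h).addCell x (hT ▸ h2) = b.remove y hy := by
    refine Eq.trans ?_ e2
    congr 1
  rw [e1, e2', p1, hT, p2] at key
  have hxc := Idx.mem_cells_of_mem_removable hx
  have hyc := Idx.mem_cells_of_mem_removable hy
  have hne : x.2 ≠ y.2 := fun e => hyx (cells_eq_of_snd_eq hyc hxc e.symm)
  have hs := sign_swap (R := k) (mem_cells.1 hxc).1 (mem_cells.1 hyc).1 hne 1 1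
  have sq : ∀ p : ℕ, ((-1 : k) ^ p) * (-1) ^ p = 1 := fun p => by
    rw [← mul_pow]; simp
  have q1 := sq (pos (b.1.2.erase x.2) y.2)
  have q2 := sq (pos (b.1.2.erase y.2) x.2)
  simp only [mul_one] at hs
  linear_combination (-1) ^ pos b.1.2 x.2 * (-1) ^ pos (b.1.2.erase x.2) y.2 * key
    - (-1) ^ pos (b.1.2.erase y.2) x.2 * c (b.remove y hy) y * hs
    - (-1) ^ pos b.1.2 x.2 * c (b.remove x hx) x * q1
    + (-1) ^ pos b.1.2 y.2 * c (b.remove y hy) y * q2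

/-- Removing both `x` and `y` is impossible only if they share a row with `α = 1`. As the entries of
`α` sum to `j + 2 ≥ 2`, another row has a removable cell `z`, and both values are compared with the
one at `z`. -/
theorem eq_of_mem_removable (hc : IsLinearCycle c) {b : Idx n Δ (j + 2)}
    {x y : Fin n × Fin m} (hx : x ∈ b.removable) (hy : y ∈ b.removable) :
    (-1) ^ pos b.1.2 x.2 * c (b.remove x hx) x = (-1) ^ pos b.1.2 y.2 * c (b.remove y hy) y := by
  by_cases hxy : x = y
  · subst hxy; rfl
  by_cases h : y ∈ (b.remove x hx).removable
  · exact hc.eq_of_mem_removable_remove hx hy h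
  have hyx : y ∈ (b.remove x hx).cells := by
    rw [b.cells_remove hx, Finset.mem_erase]
    exact ⟨Ne.symm hxy, Idx.mem_cells_of_mem_removable hy⟩
  have h0 : (b.remove x hx).1.1 y.1 = 0 := by
    by_contra h0
    exact h (Idx.mem_removable_of_pos _ hyx (Nat.pos_of_ne_zero h0))
  have hfst : y.1 = x.1 := by
    by_contra hne
    have := (mem_indexSet.1 hy).1
    simp [Idx.remove, hne] at h0
    omega
  obtain ⟨l, hl⟩ := (b.remove x hx).exists_pos
  have hlx : l ≠ x.1 := by
    rintro rfl
    rw [hfst] at h0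
    omega
  have hl' : 0 < b.1.1 l := by simpa [Idx.remove, hlx] using hl
  obtain ⟨a, ha⟩ := exists_mem_cells_row b.card_eq_add_sum l
  have hz : (l, a) ∈ b.removable := b.mem_removable_of_pos ha hl'
  rw [hc.eq_of_mem_removable_remove hx hz (b.mem_removable_remove hx hz hlx),
    hc.eq_of_mem_removable_remove hy hz (b.mem_removable_remove hy hz (hfst ▸ hlx))]

end IsLinearCycle

end SparseEN

/-! ### Coefficients of the differentials in low degrees -/

namespace SparseEN

variable {n m : ℕ} {k : Type u} [Field k] {Δ : PreAbstractSimplicialComplex (Fin m)}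

/-- The exponent vector of a variable. -/
abbrev varExp (x : Fin n × Fin m) : Vars n m →₀ ℕ := Finsupp.single (toLex x) 1

theorem varExp_injective : Function.Injective (varExp : Fin n × Fin m → Vars n m →₀ ℕ) :=
  fun _ _ h => toLex.injective (Finsupp.single_left_injective one_ne_zero h)

theorem coeff_add_sign_X_mul (p : ℕ) (q x y : Fin n × Fin m) (f : Ring n m k) :
    coeff (varExp x + varExp y) ((-1) ^ p * X (toLex q) * f) =
      if q = x then (-1) ^ p * coeff (varExp y) f else
        if q = y then (-1) ^ p * coeff (varExp x) f else 0 := by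
  have h : ((-1) ^ p * X (toLex q) * f : Ring n m k) = C ((-1) ^ p) * (X (toLex q) * f) := by
    simp [mul_assoc]
  rw [h, coeff_C_mul, mul_comm (X _), coeff_mul_X']
  by_cases h1 : q = x
  · subst h1
    simp
  · by_cases h2 : q = y
    · subst h2
      simp [h1]
    · rw [if_neg h1, if_neg h2, if_neg, mul_zero]
      simp [Ne.symm h1, Ne.symm h2]

theorem coeff_sign_X_mul (p : ℕ) (q x : Fin n × Fin m) (f : Ring n m k) :
    coeff (varExp x) ((-1) ^ p * X (toLex q) * f) =
      if q = x then (-1) ^ p * coeff 0 f else 0 := by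
  have h : ((-1) ^ p * X (toLex q) * f : Ring n m k) = C ((-1) ^ p) * (X (toLex q) * f) := by
    simp [mul_assoc]
  rw [h, coeff_C_mul, mul_comm (X _), coeff_mul_X']
  by_cases h1 : q = x
  · subst h1
    simp
  · rw [if_neg h1, if_neg, mul_zero]
    simpa using h1

-- One variable of `x y` comes from the added cell, the other from the entry of `v`. For `x = y` the
-- two choices coincide, hence the `0` in the second summand.
open Classical in
theorem coeff_add_diff_succ {j : ℕ} (v : Idx n Δ (j + 1) →₀ Ring n m k) (T : Idx n Δ j)
    (x y : Fin n × Fin m) :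
    coeff (varExp x + varExp y) ((diff (j + 1) v : Idx n Δ j →₀ Ring n m k) T) =
      (if h : T.Addable x then
        (-1) ^ pos T.1.2 x.2 * coeff (varExp y) (v (T.addCell x h)) else 0) +
      if x = y then 0 else if h : T.Addable y then
        (-1) ^ pos T.1.2 y.2 * coeff (varExp x) (v (T.addCell y h)) else 0 := by
  rw [diff_succ_apply, coeff_sum]
  have h1 : ∀ q : Fin n × Fin m, coeff (varExp x + varExp y)
      (if h : T.Addable q then (-1) ^ pos T.1.2 q.2 * X (toLex q) * v (T.addCell q h) else 0) =
      (if q = x then (if h : T.Addable x then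
        (-1) ^ pos T.1.2 x.2 * coeff (varExp y) (v (T.addCell x h)) else 0) else 0) +
      if q = y then (if x = y then 0 else if h : T.Addable y then
        (-1) ^ pos T.1.2 y.2 * coeff (varExp x) (v (T.addCell y h)) else 0) else 0 := by
    intro q
    by_cases hq : T.Addable q
    · rw [dif_pos hq, coeff_add_sign_X_mul]
      by_cases hx : q = x
      · subst hx
        by_cases hy : q = y
        · subst hy
          simp [hq]
        · simp [hq, hy]
      · by_cases hy : q = y
        · subst hy
          simp [hx, hq, Ne.symm hx]
        · simp [hx, hy]
    · rw [dif_neg hq, coeff_zero]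
      by_cases hx : q = x
      · subst hx
        by_cases hy : q = y
        · subst hy
          simp [hq]
        · simp [hq, hy]
      · by_cases hy : q = y
        · subst hy
          simp [hx, hq]
        · simp [hx, hy]
  rw [Finset.sum_congr rfl fun q _ => h1 q, Finset.sum_add_distrib]
  simp

theorem isLinearCycle_coeff {j : ℕ} {v : Idx n Δ (j + 1) →₀ Ring n m k}
    (hv : (diff (j + 1) v : Idx n Δ j →₀ Ring n m k) = 0) :
    IsLinearCycle fun S x => coeff (varExp x) (v S) := by
  classical
  refine ⟨fun T x h => ?_, fun T x y h hxy hx => ?_, fun T x y hx hy hxy => ?_⟩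
  · have := coeff_add_diff_succ v T x x
    rw [hv] at this
    simpa [h] using this.symm
  · have := coeff_add_diff_succ v T x y
    rw [hv] at this
    simpa [h, hxy, hx] using this.symm
  · have := coeff_add_diff_succ v T x y
    rw [hv] at this
    simpa [hy, hxy, hx] using this.symm

/-- For a removable cell `y` of `S`, the variable `y` occurs in the entry of the differential at `S
- y` with coefficient plus or minus the constant term of `v S`. -/
theorem coeff_zero_eq_zero_of_diff_succ {j : ℕ} {v : Idx n Δ (j + 1) →₀ Ring n m k}
    (hv : (diff (j + 1) v : Idx n Δ j →₀ Ring n m k) = 0) (S : Idx n Δ (j + 1)) :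
    coeff 0 (v S) = 0 := by
  classical
  obtain ⟨l, hl⟩ := S.exists_pos
  obtain ⟨a, ha⟩ := exists_mem_cells_row S.card_eq_add_sum l
  have hy := S.mem_removable_of_pos ha hl
  have h := congrArg (coeff (varExp (l, a))) (diff_succ_apply v (S.remove _ hy))
  rw [hv, coeff_sum, Finset.sum_eq_single (l, a)] at h
  · rw [dif_pos (S.addable_remove hy), coeff_sign_X_mul, if_pos rfl, S.remove_addCell hy] at h
    simpa using h.symm
  · intro q _ hq
    split_ifs
    · rw [coeff_sign_X_mul, if_neg hq]
    · exact coeff_zero _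
  · simp

/-! ### Initial monomials -/

/-- The exponent vector of the product of the variables in `P`. -/
def cellsExp (P : Finset (Fin n × Fin m)) : Vars n m →₀ ℕ := ∑ q ∈ P, varExp q

theorem cellsExp_apply (P : Finset (Fin n × Fin m)) (q : Fin n × Fin m) :
    cellsExp P (toLex q) = if q ∈ P then 1 else 0 := by
  simp [cellsExp, Finsupp.finsetSum_apply, Finsupp.single_apply]

theorem cellsExp_insert {P : Finset (Fin n × Fin m)} {x : Fin n × Fin m} (h : x ∉ P) :
    cellsExp (insert x P) = cellsExp P + varExp x := by
  rw [cellsExp, Finset.sum_insert h, add_comm]; rfl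

theorem subset_insert_of_cellsExp_le {P Q : Finset (Fin n × Fin m)} {x : Fin n × Fin m}
    (h : cellsExp Q ≤ cellsExp P + varExp x) : Q ⊆ insert x P := by
  intro q hq
  have h1 := h (toLex q)
  rw [Finsupp.add_apply, cellsExp_apply, cellsExp_apply, if_pos hq] at h1
  rw [Finset.mem_insert]
  by_contra! hcon
  simp [hcon.2, Ne.symm hcon.1] at h1

theorem subset_of_cellsExp_le {P Q : Finset (Fin n × Fin m)}
    (h : cellsExp Q ≤ cellsExp P) : Q ⊆ P := by
  intro q hq
  have h1 := h (toLex q)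
  rw [cellsExp_apply, cellsExp_apply, if_pos hq] at h1
  by_contra hcon
  simp [hcon] at h1

theorem Idx.eq_zero (S : Idx n Δ 0) : S.1.1 = 0 := by
  funext l
  exact (Finset.sum_eq_zero_iff.1 S.2.2.2) l (Finset.mem_univ l)

theorem mem_cells_zero (S : Idx n Δ 0) (q : Fin n × Fin m) :
    q ∈ S.cells ↔ q.2 ∈ S.1.2 ∧ pos S.1.2 q.2 = q.1 := by
  rw [mem_cells, S.eq_zero]
  simp only [Pi.zero_apply, Finset.sum_const_zero, add_zero]
  constructor
  · rintro ⟨h1, h2, h3⟩; exact ⟨h1, by omega⟩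
  · rintro ⟨h1, h2⟩; exact ⟨h1, by omega, by omega⟩

theorem initialMinor_eq_monomial (S : Idx n Δ 0) :
    initialMinor k S.1.2 (card_eq S) = monomial (cellsExp S.cells) 1 := by
  rw [initialMinor_eq, cellsExp, monomial_sum_one]
  refine Finset.prod_bij (fun i _ => (i, S.1.2.orderEmbOfFin (card_eq S) i)) ?_ ?_ ?_ ?_
  · intro i _
    rw [mem_cells_zero]
    exact ⟨Finset.orderEmbOfFin_mem _ _ _, pos_orderEmbOfFin _ _ _⟩
  · intro i _ j _ h
    exact congrArg Prod.fst h
  · intro q hq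
    obtain ⟨h1, h2⟩ := (mem_cells_zero S q).1 hq
    refine ⟨q.1, Finset.mem_univ _, Prod.ext rfl ?_⟩
    exact pos_injOn (Finset.orderEmbOfFin_mem _ _ _) h1 ((pos_orderEmbOfFin _ _ _).trans h2.symm)
  · intro i _
    rfl

/-- The cells determine the column set, and both column sets have `n` elements. So no generator of
the ideal divides another. -/
theorem Idx.eq_of_cells_subset {S S' : Idx n Δ 0} (h : S'.cells ⊆ S.cells) : S' = S := by
  have h2 : S'.1.2 ⊆ S.1.2 := by
    intro a ha
    obtain ⟨l, hl⟩ := exists_mem_cells_of_mem S'.card_eq_add_sum ha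
    exact (mem_cells.1 (h hl)).1
  refine Subtype.ext (Prod.ext (S'.eq_zero.trans S.eq_zero.symm) ?_)
  exact Finset.eq_of_subset_of_card_le h2 (by rw [S.2.2.1, S'.2.2.1])

theorem Idx.mem_and_notMem_of_subset_insert {S S' : Idx n Δ 0} {x : Fin n × Fin m}
    (h : S'.cells ⊆ insert x S.cells) (hne : S' ≠ S) : x ∈ S'.cells ∧ x ∉ S.cells := by
  constructor
  · by_contra hx
    refine hne (Idx.eq_of_cells_subset fun q hq => ?_)
    rcases Finset.mem_insert.1 (h hq) with rfl | h'
    · exact absurd hq hx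
    · exact h'
  · intro hx
    rw [Finset.insert_eq_of_mem hx] at h
    exact hne (Idx.eq_of_cells_subset h)

theorem Idx.eq_of_fst_eq {S : Idx n Δ 0} {q r : Fin n × Fin m} (hq : q ∈ S.cells)
    (hr : r ∈ S.cells) (h : q.1 = r.1) : q = r :=
  cells_eq_of_fst_eq hq hr h (by rw [S.eq_zero]; rfl)

theorem diff_zero_apply [Fintype (Idx n Δ 0)] (v : Idx n Δ 0 →₀ Ring n m k) :
    (diff 0 v : Basis n Δ 0 →₀ Ring n m k) () =
      ∑ S : Idx n Δ 0, v S * monomial (cellsExp S.cells) 1 := by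
  have h : (diff 0 v : Basis n Δ 0 →₀ Ring n m k) =
      ∑ S : Idx n Δ 0, v S • Finsupp.single () (initialMinor k S.1.2 (card_eq S)) :=
    (Finsupp.linearCombination_apply (Ring n m k) v).trans (Finsupp.sum_fintype _ _ (by simp))
  rw [h, Finsupp.finsetSum_apply]
  refine Finset.sum_congr rfl fun S _ => ?_
  rw [Finsupp.smul_apply, Finsupp.single_eq_same, initialMinor_eq_monomial, smul_eq_mul]

theorem coeff_zero_eq_zero_of_diff_zero {v : Idx n Δ 0 →₀ Ring n m k}
    (hv : (diff 0 v : Basis n Δ 0 →₀ Ring n m k) = 0) (S : Idx n Δ 0) : coeff 0 (v S) = 0 := by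
  classical
  have := finite_Idx (n := n) (Δ := Δ) 0
  have := Fintype.ofFinite (Idx n Δ 0)
  have h := congrArg (coeff (cellsExp S.cells)) (diff_zero_apply v)
  rw [hv, coeff_sum, Finset.sum_eq_single S] at h
  · rw [coeff_mul_monomial'] at h
    simpa using h.symm
  · intro S' _ hne
    rw [coeff_mul_monomial', if_neg]
    exact fun hle => hne (Idx.eq_of_cells_subset (subset_of_cellsExp_le hle))
  · simp

-- This is the coefficient of `diff 0 v` at the monomial of `S` times `x`; only generators dividing
-- that monomial contribute.
open Classical in
theorem sum_coeff_eq_zero_of_diff_zero [Fintype (Idx n Δ 0)] {v : Idx n Δ 0 →₀ Ring n m k}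
    (hv : (diff 0 v : Basis n Δ 0 →₀ Ring n m k) = 0) (S : Idx n Δ 0) (x : Fin n × Fin m) :
    ∑ S' : Idx n Δ 0, (if cellsExp S'.cells ≤ cellsExp S.cells + varExp x then
      coeff (cellsExp S.cells + varExp x - cellsExp S'.cells) (v S') else 0) = 0 := by
  have h := congrArg (coeff (cellsExp S.cells + varExp x)) (diff_zero_apply v)
  rw [hv, coeff_sum] at h
  rw [Finsupp.zero_apply, coeff_zero] at h
  refine (Finset.sum_congr rfl fun S' _ => ?_).trans h.symm
  rw [coeff_mul_monomial', mul_one]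

/-- No generator other than that of `S` divides the monomial of `S` times `x`. Such an `S'` would
arise from `S` by replacing the cell of row `x.1` by `x`, so erasing either of two neighbours in `σ
∪ {x}` would give a face, making it a 1-nonface. -/
theorem coeff_eq_zero_of_diff_zero {v : Idx n Δ 0 →₀ Ring n m k}
    (hv : (diff 0 v : Basis n Δ 0 →₀ Ring n m k) = 0)
    (hΔ : ∀ σ : Finset (Fin m), n + 1 ≤ σ.card → ¬ IsNonface Δ 1 σ)
    (S : Idx n Δ 0) (x : Fin n × Fin m) (hx : ¬ S.Addable x) : coeff (varExp x) (v S) = 0 := by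
  classical
  have := finite_Idx (n := n) (Δ := Δ) 0
  have := Fintype.ofFinite (Idx n Δ 0)
  have h := sum_coeff_eq_zero_of_diff_zero hv S x
  rw [Finset.sum_eq_single S] at h
  · simpa using h
  · intro S' _ hne
    rw [if_neg]
    intro hle
    have hsub := subset_insert_of_cellsExp_le hle
    obtain ⟨hxS', hxS⟩ := Idx.mem_and_notMem_of_subset_insert hsub hne
    have hS := S.card_eq_add_sum
    -- Outside the row of `x`, the elements `S` and `S'` have the same cells, so `x` inherits from
    -- `S'` its compatibility with them.
    have hmem : ∀ q ∈ S.cells, q.1 ≠ x.1 → q ∈ S'.cells := by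
      intro q hq hqx
      obtain ⟨a, ha⟩ := exists_mem_cells_row S'.card_eq_add_sum q.1
      rcases Finset.mem_insert.1 (hsub ha) with e | h'
      · exact absurd (congrArg Prod.fst e) hqx
      · rwa [Idx.eq_of_fst_eq hq h' rfl]
    obtain ⟨hxσ, hxi⟩ := mem_indexSet_insert hS hxS
      (fun q hq hlt => cells_ordered (hmem q hq hlt.ne) hxS' hlt)
      (fun q hq hlt => cells_ordered hxS' (hmem q hq hlt.ne') hlt)
    have hnot : insert x.2 S.1.2 ∉ Δ := fun h => hx ⟨hxσ, h, hxi⟩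
    have hcells := cells_insert hxσ hxi
    have hnf := hΔ (insert x.2 S.1.2) (by rw [Finset.card_insert_of_notMem hxσ, S.2.2.1])
    have hex : (insert x.2 S.1.2).erase x.2 ∈ Δ := by
      rw [Finset.erase_insert hxσ]; exact S.2.1
    obtain ⟨b, hb, hb'⟩ := exists_neighbour_mem_cells (card_insert_eq hS hxσ)
      (hcells ▸ Finset.mem_insert_self _ _) (by simp)
    have hbσ := (mem_cells.1 hb).1
    rw [hcells, Finset.mem_insert] at hb
    have hbx : b ≠ x.2 := by
      rintro rfl
      omega
    have hb2 : (x.1, b) ∈ S.cells := hb.resolve_left fun e => hbx (congrArg Prod.snd e)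
    -- This set is the column set of `S'`: `S'` has one cell per row, which in the row of `x` is `x`
    -- and not `b`.
    have hbΔ : (insert x.2 S.1.2).erase b ∈ Δ := by
      have hsub' : S'.1.2 ⊆ (insert x.2 S.1.2).erase b := by
        intro a ha
        obtain ⟨l, hl⟩ := exists_mem_cells_of_mem S'.card_eq_add_sum ha
        rw [Finset.mem_erase, Finset.mem_insert]
        rcases Finset.mem_insert.1 (hsub hl) with e | h'
        · have ha : a = x.2 := congrArg Prod.snd e
          exact ⟨ha ▸ hbx.symm, Or.inl ha⟩
        · refine ⟨?_, Or.inr (mem_cells.1 h').1⟩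
          rintro rfl
          have e := cells_eq_of_snd_eq h' hb2 rfl
          rw [e] at hl
          exact hbx (congrArg Prod.snd (Idx.eq_of_fst_eq hl hxS' rfl))
      have : S'.1.2 = (insert x.2 S.1.2).erase b := by
        refine Finset.eq_of_subset_of_card_le hsub' ?_
        rw [Finset.card_erase_of_mem hbσ, Finset.card_insert_of_notMem hxσ, S.2.2.1, S'.2.2.1]
        omega
      rw [← this]; exact S'.2.1
    rcases hb' with h | h
    · exact hnf (isNonface_one hnot (by simp) hbσ h hex hbΔ)
    · exact hnf (isNonface_one hnot hbσ (by simp) h hbΔ hex)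
  · simp

/-- Here `x` and `y` are the two cells of the only row with `α = 1`, and `b - x`, `b - y` are the
only generators dividing the monomial of `b`. The cycle equation at that monomial has just these two
terms. -/
theorem coeff_eq_of_diff_zero {v : Idx n Δ 0 →₀ Ring n m k}
    (hv : (diff 0 v : Basis n Δ 0 →₀ Ring n m k) = 0) {b : Idx n Δ 1} {x y : Fin n × Fin m}
    (hx : x ∈ b.removable) (hy : y ∈ b.removable) :
    (-1) ^ pos b.1.2 x.2 * coeff (varExp x) (v (b.remove x hx)) =
      (-1) ^ pos b.1.2 y.2 * coeff (varExp y) (v (b.remove y hy)) := by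
  classical
  by_cases hxy : x = y
  · subst hxy; rfl
  have := finite_Idx (n := n) (Δ := Δ) 0
  have := Fintype.ofFinite (Idx n Δ 0)
  have h := sum_coeff_eq_zero_of_diff_zero hv (b.remove x hx) x
  have hxb := Idx.mem_cells_of_mem_removable hx
  have hyb := Idx.mem_cells_of_mem_removable hy
  have hrow : (b.1.1 - Pi.single x.1 1 : Fin n → ℕ) = 0 := (b.remove x hx).eq_zero
  have hfst : y.1 = x.1 := by
    by_contra hne
    have h1 := congrFun hrow y.1
    have h2 := (mem_indexSet.1 hy).1
    simp [hne] at h1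
    omega
  have hone : b.1.1 x.1 = 1 := by
    have h1 := congrFun hrow x.1
    have h2 := (mem_indexSet.1 hx).1
    simp at h1
    omega
  have hins : ∀ z (hz : z ∈ b.removable),
      cellsExp (b.remove z hz).cells + varExp z = cellsExp b.cells := by
    intro z hz
    rw [b.cells_remove hz, ← cellsExp_insert (Finset.notMem_erase _ _),
      Finset.insert_erase (Idx.mem_cells_of_mem_removable hz)]
  have hne : b.remove x hx ≠ b.remove y hy := by
    intro e
    have h1 := b.cells_remove hx
    rw [e, b.cells_remove hy] at h1
    have : x ∈ b.cells.erase y := Finset.mem_erase.2 ⟨hxy, hxb⟩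
    rw [h1] at this
    simp at this
  rw [Finset.sum_eq_add (b.remove x hx) (b.remove y hy) hne, if_pos (by simp),
    if_pos (by rw [hins x hx, ← hins y hy]; simp)] at h
  · rw [add_tsub_cancel_left, hins x hx, ← hins y hy, add_tsub_cancel_left] at h
    -- The block has exactly two elements, so their positions are consecutive.
    have hpos : ((-1 : k) ^ pos b.1.2 x.2) = - (-1) ^ pos b.1.2 y.2 := by
      obtain ⟨hx2, h1, h1'⟩ := mem_cells.1 hxb
      obtain ⟨hy2, h2, h2'⟩ := mem_cells.1 hyb
      rw [sum_Iic_eq] at h1' h2'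
      rw [hfst] at h2 h2'
      rw [hone] at h1' h2'
      have h3 : pos b.1.2 x.2 ≠ pos b.1.2 y.2 := fun e =>
        hxy (Prod.ext hfst.symm (pos_injOn hx2 hy2 e))
      obtain h4 | h4 : pos b.1.2 x.2 = pos b.1.2 y.2 + 1 ∨ pos b.1.2 y.2 = pos b.1.2 x.2 + 1 := by
        omega
      · rw [h4, pow_succ]; ring
      · rw [h4, pow_succ]; ring
    rw [hpos]
    linear_combination (-(-1) ^ pos b.1.2 y.2) * h
  -- A further divisor would contain `x`, hence omit `y`, which lies in the same row; this forces it
  -- to be `b - y`.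
  · rintro S' - ⟨hS1, hS2⟩
    rw [if_neg]
    intro hle
    have hsub := subset_insert_of_cellsExp_le hle
    obtain ⟨hxS', -⟩ := Idx.mem_and_notMem_of_subset_insert hsub hS1
    refine hS2 (Idx.eq_of_cells_subset fun q hq => ?_)
    rw [b.cells_remove hx, Finset.insert_erase hxb] at hsub
    rw [b.cells_remove hy, Finset.mem_erase]
    refine ⟨?_, hsub hq⟩
    rintro rfl
    exact hxy (Idx.eq_of_fst_eq hxS' hq hfst.symm)
  · simp
  · simp

end SparseEN

namespace SparseEN

variable {n m : ℕ} {k : Type u} [Field k] {Δ : PreAbstractSimplicialComplex (Fin m)}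

/-! ### Vanishing of homology -/

-- The weight of `b` is the common value given by `h1`; every addable pair `(S, x)` arises from
-- removing `x` from `b = S + x`.
open Classical in
theorem exists_weight {j : ℕ} {c : Idx n Δ j → Fin n × Fin m → k}
    (h0 : ∀ S x, ¬ Idx.Addable S x → c S x = 0)
    (h1 : ∀ (b : Idx n Δ (j + 1)) x y (hx : x ∈ b.removable) (hy : y ∈ b.removable),
      (-1) ^ pos b.1.2 x.2 * c (b.remove x hx) x = (-1) ^ pos b.1.2 y.2 * c (b.remove y hy) y) :
    ∃ w : Idx n Δ (j + 1) → k, ∀ S x, c S x = if h : Idx.Addable S x then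
      (-1) ^ pos S.1.2 x.2 * w (S.addCell x h) else 0 := by
  have hex : ∀ b : Idx n Δ (j + 1), ∃ w : k, ∀ x (hx : x ∈ b.removable),
      w = (-1) ^ pos b.1.2 x.2 * c (b.remove x hx) x := by
    intro b
    by_cases hb : ∃ x, x ∈ b.removable
    · obtain ⟨y, hy⟩ := hb
      exact ⟨(-1) ^ pos b.1.2 y.2 * c (b.remove y hy) y, fun x hx => h1 b y x hy hx⟩
    · exact ⟨0, fun x hx => absurd ⟨x, hx⟩ hb⟩
  choose w hw using hex
  refine ⟨w, fun S x => ?_⟩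
  by_cases h : S.Addable x
  · rw [dif_pos h, hw _ x (S.mem_removable_addCell h), S.addCell_remove h,
      show (S.addCell x h).1.2 = insert x.2 S.1.2 from rfl, pos_insert_self, ← mul_assoc,
      ← mul_pow]
    simp
  · rw [dif_neg h, h0 S x h]

theorem eq_sum_of_coeff {f : Ring n m k} (hf : ∀ s, coeff s f ≠ 0 → s.degree = 1) :
    f = ∑ x : Fin n × Fin m, X (toLex x) * C (coeff (varExp x) f) := by
  ext s
  rw [coeff_sum]
  have h1 : ∀ x : Fin n × Fin m, coeff s (X (toLex x) * C (coeff (varExp x) f)) =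
      if varExp x = s then coeff s f else 0 := by
    intro x
    rw [mul_comm, coeff_C_mul, coeff_X]
    by_cases h : varExp x = s
    · rw [if_pos h, if_pos h, mul_one, h]
    · rw [if_neg h, if_neg h, mul_zero]
  rw [Finset.sum_congr rfl fun x _ => h1 x]
  by_cases hs : coeff s f = 0
  · simp [hs]
  · obtain ⟨x, hx⟩ := (Finsupp.sum_eq_one_iff s).1 (hf s hs)
    subst hx
    rw [Finset.sum_eq_single (ofLex x)]
    · exact (if_pos rfl).symm
    · intro y _ hy
      rw [if_neg]
      intro e
      exact hy (varExp_injective e)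
    · simp

/-- The weights, read as constant polynomials, form the preimage; the entries of its differential
are matched with linear forms one variable at a time. -/
theorem exists_diff_eq {j : ℕ} {v : Idx n Δ j →₀ Ring n m k}
    (hdeg : ∀ S s, coeff s (v S) ≠ 0 → s.degree = 1)
    (h0 : ∀ S x, ¬ Idx.Addable S x → coeff (varExp x) (v S) = 0)
    (h1 : ∀ (b : Idx n Δ (j + 1)) x y (hx : x ∈ b.removable) (hy : y ∈ b.removable),
      (-1) ^ pos b.1.2 x.2 * coeff (varExp x) (v (b.remove x hx)) =
        (-1) ^ pos b.1.2 y.2 * coeff (varExp y) (v (b.remove y hy))) :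
    ∃ w : Idx n Δ (j + 1) →₀ Ring n m k, (∀ b s, coeff s (w b) ≠ 0 → s.degree = 0) ∧
      (diff (j + 1) w : Idx n Δ j →₀ Ring n m k) = v := by
  classical
  obtain ⟨w, hw⟩ := exists_weight (c := fun S x => coeff (varExp x) (v S)) h0 h1
  have := finite_Idx (n := n) (Δ := Δ) (j + 1)
  refine ⟨Finsupp.equivFunOnFinite.symm fun b => C (w b), ?_, ?_⟩
  · intro b s hs
    by_contra hne
    refine hs ?_
    simp only [Finsupp.equivFunOnFinite_symm_apply_apply]
    rw [coeff_C, if_neg]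
    rintro rfl
    simp at hne
  · refine Finsupp.ext fun S => ?_
    rw [diff_succ_apply, eq_sum_of_coeff (hdeg S)]
    refine Finset.sum_congr rfl fun x _ => ?_
    rw [hw S x]
    split_ifs with h
    · simp only [Finsupp.equivFunOnFinite_symm_apply_apply, map_mul, map_pow, map_neg, map_one]
      ring
    · simp

/-- In the degree of the basis vectors all entries are constants, and the constant terms of a cycle
vanish. -/
theorem eq_zero_of_mem_piece (j : ℕ) {v : (sparseENComplex n k Δ).X (j + 1)}
    (hv : v ∈ (sparseENComplex n k Δ).piece (j + 1) (n + j))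
    (h : (sparseENComplex n k Δ).d j v = 0) : v = 0 := by
  refine Finsupp.ext fun S => MvPolynomial.ext _ _ fun s => ?_
  by_contra hs
  have hdeg : s.degree + (n + j) = n + j := hv S s hs
  obtain rfl : s = 0 := (Finsupp.degree_eq_zero_iff s).1 (by omega)
  refine hs ?_
  cases j with
  | zero => exact coeff_zero_eq_zero_of_diff_zero h S
  | succ j => exact coeff_zero_eq_zero_of_diff_succ h S

theorem exists_d_eq_of_mem_piece
    (hΔ : ∀ σ : Finset (Fin m), n + 1 ≤ σ.card → ¬ IsNonface Δ 1 σ)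
    (j : ℕ) {v : (sparseENComplex n k Δ).X (j + 1)}
    (hv : v ∈ (sparseENComplex n k Δ).piece (j + 1) (n + j + 1))
    (h : (sparseENComplex n k Δ).d j v = 0) :
    ∃ w ∈ (sparseENComplex n k Δ).piece (j + 2) (n + j + 1),
      (sparseENComplex n k Δ).d (j + 1) w = v := by
  have hdeg : ∀ (S : Idx n Δ j) s, coeff s (v S) ≠ 0 → s.degree = 1 := by
    intro S s hs
    have : s.degree + (n + j) = n + j + 1 := hv S s hs
    omega
  have key : ∃ w : Idx n Δ (j + 1) →₀ Ring n m k, (∀ b s, coeff s (w b) ≠ 0 → s.degree = 0) ∧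
      (diff (j + 1) w : Idx n Δ j →₀ Ring n m k) = v := by
    cases j with
    | zero =>
      exact exists_diff_eq hdeg (coeff_eq_zero_of_diff_zero h hΔ)
        fun b x y hx hy => coeff_eq_of_diff_zero h hx hy
    | succ j =>
      exact exists_diff_eq hdeg ((isLinearCycle_coeff h).eq_zero hΔ)
        fun b x y hx hy => (isLinearCycle_coeff h).eq_of_mem_removable hx hy
  obtain ⟨w, hw, hwv⟩ := key
  refine ⟨w, fun b s hs => ?_, hwv⟩
  change s.degree + (n + (j + 1)) = n + j + 1
  have := hw b s hs
  omega

end SparseEN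

/-! ### Homogeneous elements of graded free modules -/

namespace GradedFree

variable {V : Type} {k : Type u} [Field k] {B : Type}

/-- The vector `v` is homogeneous of degree `e`, where the basis vector `b` has degree `deg b`. -/
def IsHom (deg : B → ℕ) (e : ℕ) (v : B →₀ MvPolynomial V k) : Prop :=
  ∀ c s, coeff s (v c) ≠ 0 → s.degree + deg c = e

/-- The homogeneous component of degree `e`. -/
def comp [Finite B] (deg : B → ℕ) (e : ℕ) :
    (B →₀ MvPolynomial V k) →+ (B →₀ MvPolynomial V k) where
  toFun v := Finsupp.equivFunOnFinite.symm fun c =>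
    -- Without the guard, truncated subtraction would pick up the constant term when `e < deg c`.
    if deg c ≤ e then homogeneousComponent (e - deg c) (v c) else 0
  map_zero' := by
    ext c
    simp
  map_add' v w := by
    refine Finsupp.ext fun c => ?_
    simp only [Finsupp.equivFunOnFinite_symm_apply_apply, Finsupp.add_apply, map_add]
    split_ifs <;> simp

theorem coeff_comp [Finite B] (deg : B → ℕ) (e : ℕ) (v : B →₀ MvPolynomial V k) (c : B) (s : V →₀ ℕ) :
    coeff s (comp deg e v c) = if s.degree + deg c = e then coeff s (v c) else 0 := by
  change coeff s (if deg c ≤ e then homogeneousComponent (e - deg c) (v c) else 0) = _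
  by_cases h : deg c ≤ e
  · rw [if_pos h, coeff_homogeneousComponent]
    congr 1
    rw [eq_iff_iff]
    omega
  · rw [if_neg h, coeff_zero, if_neg (by omega)]

theorem isHom_comp [Finite B] (deg : B → ℕ) (e : ℕ) (v : B →₀ MvPolynomial V k) :
    IsHom deg e (comp deg e v) := by
  intro c s h
  by_contra hne
  rw [coeff_comp, if_neg hne] at h
  exact h rfl

theorem IsHom.comp_eq [Finite B] {deg : B → ℕ} {e : ℕ} {v : B →₀ MvPolynomial V k} (h : IsHom deg e v)
    (d : ℕ) : comp deg d v = if e = d then v else 0 := by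
  refine Finsupp.ext fun c => MvPolynomial.ext _ _ fun s => ?_
  rw [coeff_comp]
  by_cases hs : coeff s (v c) = 0
  · split_ifs <;> simp [hs]
  · rw [h c s hs]
    split_ifs <;> simp

theorem exists_eq_sum_comp [Finite B] (deg : B → ℕ) (v : B →₀ MvPolynomial V k) :
    ∃ M, v = ∑ e ∈ Finset.range M, comp deg e v := by
  have := Fintype.ofFinite B
  -- The sum over the basis serves as a bound for each single degree occurring in `v`.
  refine ⟨∑ c, ((v c).totalDegree + deg c) + 1, ?_⟩
  refine Finsupp.ext fun c => MvPolynomial.ext _ _ fun s => ?_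
  rw [Finsupp.finsetSum_apply, coeff_sum, Finset.sum_congr rfl fun e _ => coeff_comp deg e v c s,
    Finset.sum_ite_eq]
  split_ifs with h
  · rfl
  · by_contra hs
    refine h (Finset.mem_range.2 (Nat.lt_succ_of_le ?_))
    refine le_trans ?_ (Finset.single_le_sum (f := fun c => (v c).totalDegree + deg c)
      (fun _ _ => Nat.zero_le _) (Finset.mem_univ c))
    exact Nat.add_le_add_right (le_totalDegree (mem_support_iff.2 hs)) _

theorem IsHom.monomial_smul {deg : B → ℕ} {e : ℕ} {v : B →₀ MvPolynomial V k}
    (h : IsHom deg e v) (u : V →₀ ℕ) (r : k) :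
    IsHom deg (u.degree + e) (monomial u r • v) := by
  intro c s hs
  rw [Finsupp.smul_apply, smul_eq_mul, coeff_monomial_mul'] at hs
  split_ifs at hs with hle
  · have h1 := h c (s - u) (right_ne_zero_of_mul hs)
    have h2 : s.degree = u.degree + (s - u).degree := by
      rw [← map_add, add_tsub_cancel_of_le hle]
    omega
  · exact absurd rfl hs

theorem IsHom.comp_smul [Finite B] {deg : B → ℕ} {e : ℕ} {v : B →₀ MvPolynomial V k} (h : IsHom deg e v)
    (d : ℕ) (a : MvPolynomial V k) :
    comp deg d (a • v) = (if e ≤ d then homogeneousComponent (d - e) a else 0) • v := by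
  induction a using MvPolynomial.induction_on' with
  | monomial u r =>
    rw [(h.monomial_smul u r).comp_eq d]
    have h1 : homogeneousComponent (d - e) (monomial u r) =
        if u.degree = d - e then monomial u r else 0 := by
      rw [homogeneousComponent_of_mem (isHomogeneous_monomial r rfl)]
      simp only [eq_comm]
    rw [h1]
    by_cases h2 : u.degree + e = d
    · rw [if_pos h2, if_pos (by omega), if_pos (by omega)]
    · rw [if_neg h2]
      by_cases h3 : e ≤ d
      · rw [if_pos h3, if_neg (by omega), zero_smul]
      · rw [if_neg h3, zero_smul]
  | add p q hp hq =>
    rw [add_smul, map_add, hp, hq, ← add_smul]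
    congr 1
    split_ifs <;> simp

theorem isHom_single (deg : B → ℕ) (b : B) :
    IsHom deg (deg b) (Finsupp.single b 1 : B →₀ MvPolynomial V k) := by
  classical
  intro c s hs
  rw [Finsupp.single_apply] at hs
  split_ifs at hs with h
  · subst h
    rw [coeff_one] at hs
    split_ifs at hs with h'
    · subst h'; simp
    · exact absurd rfl hs
  · simp at hs

/-- A homogeneous map commutes with taking homogeneous components. -/
theorem comp_map [Finite B] {B' : Type} [Finite B'] {deg : B → ℕ} {deg' : B' → ℕ}
    {f : (B' →₀ MvPolynomial V k) →ₗ[MvPolynomial V k] (B →₀ MvPolynomial V k)}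
    (hf : ∀ b, IsHom deg (deg' b) (f (Finsupp.single b 1))) (d : ℕ)
    (v : B' →₀ MvPolynomial V k) : comp deg d (f v) = f (comp deg' d v) := by
  induction v using Finsupp.induction_linear with
  | zero => simp
  | add v w hv hw => simp only [map_add, hv, hw]
  | single b r =>
    have h : (Finsupp.single b r : B' →₀ MvPolynomial V k) = r • Finsupp.single b 1 := by simp
    rw [h, map_smul, (hf b).comp_smul, (isHom_single deg' b).comp_smul, map_smul]

/-- Generators of a graded submodule in the lowest degree extend to a minimal system of
homogeneous generators. -/
theorem exists_minimal_generators [Finite V] [Finite B] {deg : B → ℕ}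
    {K : Submodule (MvPolynomial V k) (B →₀ MvPolynomial V k)}
    (hK : ∀ v ∈ K, ∀ e, comp deg e v ∈ K) {ι : Type} [Finite ι] {e₀ : ℕ}
    {g₀ : ι → B →₀ MvPolynomial V k} (hg₀K : ∀ i, g₀ i ∈ K) (hg₀ : ∀ i, IsHom deg e₀ (g₀ i))
    (hlt : ∀ e < e₀, ∀ v ∈ K, IsHom deg e v → v = 0)
    (hspan : ∀ v ∈ K, IsHom deg e₀ v → v ∈ Submodule.span (MvPolynomial V k) (Set.range g₀))
    (hind : ∀ a : ι →₀ MvPolynomial V k, IsHom (fun _ => e₀) e₀ a →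
      Finsupp.linearCombination (MvPolynomial V k) g₀ a = 0 → a = 0) :
    ∃ (r : ℕ) (g₁ : Fin r → B →₀ MvPolynomial V k) (deg₁ : Fin r → ℕ),
      (∀ j, e₀ < deg₁ j) ∧ (∀ j, IsHom deg (deg₁ j) (g₁ j)) ∧
      Submodule.span (MvPolynomial V k) (Set.range (Sum.elim g₀ g₁)) = K ∧
      ∀ a, Finsupp.linearCombination (MvPolynomial V k) (Sum.elim g₀ g₁) a = 0 →
        ∀ j, constantCoeff (a j) = 0 := by
  classical
  -- Admissible sets of additional generators; one of least cardinality is chosen below.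
  let P : Finset (B →₀ MvPolynomial V k) → Prop := fun t =>
    (∀ x ∈ t, ∃ e, e₀ < e ∧ IsHom deg e x) ∧
      Submodule.span (MvPolynomial V k) (Set.range g₀ ∪ t) = K
  have hex : ∃ t, P t := by
    obtain ⟨s, hs⟩ := (IsNoetherian.noetherian K)
    choose M hM using exists_eq_sum_comp (V := V) (k := k) deg
    -- The components of degree above `e₀` of a finite generating set suffice: lower components
    -- vanish and those of degree `e₀` lie in the span of `g₀`.
    refine ⟨s.biUnion fun v => ((Finset.range (M v)).filter (e₀ < ·)).image
      fun e => comp deg e v, ?_, ?_⟩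
    · intro x hx
      simp only [Finset.mem_biUnion, Finset.mem_image, Finset.mem_filter] at hx
      obtain ⟨v, -, e, ⟨-, he⟩, rfl⟩ := hx
      exact ⟨e, he, isHom_comp deg e v⟩
    · have hsK : ∀ v ∈ s, v ∈ K := fun v hv => hs ▸ Submodule.subset_span hv
      apply le_antisymm
      · rw [Submodule.span_le]
        rintro x (⟨i, rfl⟩ | hx)
        · exact hg₀K i
        · simp only [Finset.coe_biUnion, Set.mem_iUnion, Finset.coe_image, Set.mem_image] at hx
          obtain ⟨v, hv, e, -, rfl⟩ := hx
          exact hK v (hsK v hv) e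
      · rw [← hs, Submodule.span_le]
        intro v hv
        rw [hM v]
        refine Submodule.sum_mem _ fun e he => ?_
        rcases lt_trichotomy e e₀ with h | h | h
        · rw [hlt e h _ (hK v (hsK v hv) e) (isHom_comp deg e v)]
          exact Submodule.zero_mem _
        · subst h
          exact Submodule.span_mono Set.subset_union_left
            (hspan _ (hK v (hsK v hv) e) (isHom_comp deg e v))
        · refine Submodule.subset_span (Or.inr ?_)
          simp only [Finset.coe_biUnion, Set.mem_iUnion, Finset.coe_image, Set.mem_image]
          exact ⟨v, hv, e, by simpa using ⟨Finset.mem_range.1 he, h⟩, rfl⟩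
  obtain ⟨t, ht, hmin⟩ := WellFounded.has_min
    (InvImage.wf (fun t : Finset (B →₀ MvPolynomial V k) => t.card) wellFounded_lt) {t | P t} hex
  obtain ⟨hthom, htspan⟩ := ht
  let g₁ : Fin t.card → B →₀ MvPolynomial V k := fun j => (t.equivFin.symm j : _)
  have hg₁ : ∀ j, g₁ j ∈ t := fun j => (t.equivFin.symm j).2
  have hg₁inj : Function.Injective g₁ := Subtype.val_injective.comp t.equivFin.symm.injective
  have hrange : Set.range g₁ = t := by
    ext x
    constructor
    · rintro ⟨j, rfl⟩; exact hg₁ j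
    · intro hx
      exact ⟨t.equivFin ⟨x, hx⟩, by simp [g₁]⟩
  choose deg₁ hdeg₁ hhom₁ using fun j => hthom _ (hg₁ j)
  refine ⟨t.card, g₁, deg₁, hdeg₁, hhom₁, ?_, ?_⟩
  · rw [Set.Sum.elim_range, hrange, htspan]
  intro a ha j
  by_contra hj
  let D : ι ⊕ Fin t.card → ℕ := Sum.elim (fun _ => e₀) deg₁
  have hgr : ∀ b, IsHom deg (D b) (Finsupp.linearCombination (MvPolynomial V k)
      (Sum.elim g₀ g₁) (Finsupp.single b 1)) := by
    intro b
    rw [Finsupp.linearCombination_single, one_smul]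
    cases b with
    | inl i => exact hg₀ i
    | inr i => exact hhom₁ i
  -- The component in the degree of generator `j` is again a syzygy and keeps the constant term at
  -- `j`, so the syzygy may be taken homogeneous.
  set a' := comp D (D j) a with ha'
  have hker : Finsupp.linearCombination (MvPolynomial V k) (Sum.elim g₀ g₁) a' = 0 := by
    rw [ha', ← comp_map hgr, ha, map_zero]
  have hcoeff : coeff 0 (a' j) ≠ 0 := by
    rw [ha', coeff_comp, if_pos (by simp)]
    exact hj
  have hhom : IsHom D (D j) a' := isHom_comp _ _ _
  cases j with
  | inl i =>
    -- The additional generators have degree above `e₀`, so a syzygy of degree `e₀` involves only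
    -- `g₀`, and `hind` applies.
    have h0 : ∀ l, a' (Sum.inr l) = 0 := by
      intro l
      ext s
      by_contra hs
      have h1 : s.degree + deg₁ l = e₀ := hhom _ s hs
      have := hdeg₁ l
      omega
    have h1 : Finsupp.linearCombination (MvPolynomial V k) g₀
        (a'.comapDomain Sum.inl Sum.inl_injective.injOn) = 0 := by
      have := Fintype.ofFinite ι
      rw [← hker, Finsupp.linearCombination_apply, Finsupp.linearCombination_apply,
        Finsupp.sum_fintype _ _ (by simp), Finsupp.sum_fintype _ _ (by simp),
        Fintype.sum_sum_type]
      simp [h0]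
    have h2 := hind _ (fun l s hs => hhom (Sum.inl l) s hs) h1
    have h3 : a' (Sum.inl i) = 0 := DFunLike.congr_fun h2 i
    rw [h3] at hcoeff
    exact hcoeff (coeff_zero _)
  | inr i =>
    -- By homogeneity this coefficient is a nonzero constant, so `g₁ i` is redundant, against the
    -- minimality of `t`.
    have hC : a' (Sum.inr i) = C (coeff 0 (a' (Sum.inr i))) := by
      ext s
      rw [coeff_C]
      split_ifs with h
      · rw [h]
      · by_contra hs
        have h1 : s.degree + deg₁ i = deg₁ i := hhom _ s hs
        exact h ((Finsupp.degree_eq_zero_iff s).1 (by omega)).symm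
    let S := Submodule.span (MvPolynomial V k) (Set.range g₀ ∪ (t.erase (g₁ i) : Finset _))
    have hmem : g₁ i ∈ S := by
      rw [← Finsupp.single_add_erase (Sum.inr i) a', map_add,
        Finsupp.linearCombination_single] at hker
      have h1 : Finsupp.linearCombination (MvPolynomial V k) (Sum.elim g₀ g₁)
          (a'.erase (Sum.inr i)) ∈ S := by
        rw [Finsupp.linearCombination_apply]
        refine Submodule.sum_mem _ fun l hl => Submodule.smul_mem _ _ ?_
        rw [Finsupp.support_erase, Finset.mem_erase] at hl
        refine Submodule.subset_span ?_
        cases l with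
        | inl l => exact Or.inl ⟨l, rfl⟩
        | inr l =>
          refine Or.inr ?_
          rw [Finset.mem_coe, Finset.mem_erase]
          refine ⟨fun e => hl.1 ?_, hg₁ l⟩
          rw [hg₁inj e]
      have h2 : a' (Sum.inr i) • g₁ i ∈ S := by
        have : a' (Sum.inr i) • g₁ i = - Finsupp.linearCombination (MvPolynomial V k)
          (Sum.elim g₀ g₁) (a'.erase (Sum.inr i)) := eq_neg_of_add_eq_zero_left hker
        rw [this]
        exact Submodule.neg_mem _ h1
      have h3 := Submodule.smul_mem S (C (coeff 0 (a' (Sum.inr i)))⁻¹) h2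
      rwa [hC, coeff_C, if_pos rfl, smul_smul, ← C_mul, inv_mul_cancel₀ hcoeff, C_1,
        one_smul] at h3
    refine hmin (t.erase (g₁ i)) ⟨fun x hx => hthom x (Finset.mem_of_mem_erase hx), ?_⟩
      (Finset.card_erase_lt_of_mem (hg₁ i))
    rw [← htspan]
    apply le_antisymm
    · refine Submodule.span_mono (Set.union_subset_union_right _ ?_)
      exact Finset.coe_subset.2 (Finset.erase_subset _ _)
    · rw [Submodule.span_le]
      rintro x (hx | hx)
      · exact Submodule.subset_span (Or.inl hx)
      · by_cases he : x = g₁ i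
        · rw [he]; exact hmem
        · exact Submodule.subset_span (Or.inr (by simpa [he] using hx))

end GradedFree

/-! ### A minimal free resolution built around a linearly exact complex -/

namespace GradedFree

variable {V : Type} {k : Type u} [Field k]

section inl

variable {B : Type} {r : ℕ}

variable (V k B r) in
/-- The inclusion of a free module as the first summand of a larger one. -/
abbrev inlMap : (B →₀ MvPolynomial V k) →ₗ[MvPolynomial V k] (B ⊕ Fin r →₀ MvPolynomial V k) :=
  Finsupp.lmapDomain (MvPolynomial V k) (MvPolynomial V k) Sum.inl

variable (V k B r) in
/-- The projection of a free module onto its first summand. -/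
abbrev fstMap : (B ⊕ Fin r →₀ MvPolynomial V k) →ₗ[MvPolynomial V k] (B →₀ MvPolynomial V k) :=
  Finsupp.lcomapDomain Sum.inl Sum.inl_injective

theorem inlMap_inl (v : B →₀ MvPolynomial V k) (b : B) : inlMap V k B r v (Sum.inl b) = v b :=
  Finsupp.mapDomain_apply Sum.inl_injective _ _

theorem inlMap_inr (v : B →₀ MvPolynomial V k) (j : Fin r) : inlMap V k B r v (Sum.inr j) = 0 :=
  Finsupp.mapDomain_of_notMem_range _ _ (by simp)

theorem fstMap_inlMap (v : B →₀ MvPolynomial V k) : fstMap V k B r (inlMap V k B r v) = v :=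
  Finsupp.ext fun b => inlMap_inl v b

theorem inlMap_injective : Function.Injective (inlMap V k B r) :=
  Function.LeftInverse.injective fstMap_inlMap

theorem inlMap_fstMap {v : B ⊕ Fin r →₀ MvPolynomial V k} (h : ∀ j, v (Sum.inr j) = 0) :
    inlMap V k B r (fstMap V k B r v) = v := by
  refine Finsupp.ext fun b => ?_
  cases b with
  | inl b => exact inlMap_inl _ b
  | inr j => rw [inlMap_inr, h]

theorem IsHom.inlMap {deg : B → ℕ} {e : ℕ} {v : B →₀ MvPolynomial V k} (h : IsHom deg e v)
    (deg' : Fin r → ℕ) : IsHom (Sum.elim deg deg') e (GradedFree.inlMap V k B r v) := by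
  intro c s hs
  cases c with
  | inl b =>
    rw [inlMap_inl] at hs
    exact h b s hs
  | inr j =>
    rw [inlMap_inr] at hs
    exact absurd (coeff_zero _) hs

theorem range_inlMap {deg : B → ℕ} {deg' : Fin r → ℕ} {e : ℕ} (h : ∀ b, deg b = e)
    (h' : ∀ j, deg' j ≠ e) : LinearMap.range (inlMap V k B r) =
      Submodule.span (MvPolynomial V k)
        {v | ∃ b, Sum.elim deg deg' b = e ∧ v = Finsupp.single b 1} := by
  apply le_antisymm
  · rintro _ ⟨v, rfl⟩
    induction v using Finsupp.induction_linear with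
    | zero => rw [map_zero]; exact Submodule.zero_mem _
    | add v w hv hw => rw [map_add]; exact Submodule.add_mem _ hv hw
    | single b a =>
      have : inlMap V k B r (Finsupp.single b a) = a • Finsupp.single (Sum.inl b) 1 := by simp
      rw [this]
      exact Submodule.smul_mem _ _ (Submodule.subset_span ⟨Sum.inl b, h b, rfl⟩)
  · refine Submodule.span_le.2 ?_
    rintro _ ⟨b | j, hb, rfl⟩
    · exact ⟨Finsupp.single b 1, Finsupp.mapDomain_single⟩
    · exact absurd hb (h' j)

end inl

/-- The data of one step in the construction of a minimal free resolution whose linear strand is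
the truncation of `C`: the generators that do not belong to `C`, and the module of syzygies. -/
structure Stage (C : GradedFreeComplex V k) (n i : ℕ) where
  r : ℕ
  deg : Fin r → ℕ
  K : Submodule (MvPolynomial V k) (C.B (i + 1) ⊕ Fin r →₀ MvPolynomial V k)
  lt_deg : ∀ j, n + i < deg j
  graded : haveI := C.finite_B (i + 1)
    ∀ v ∈ K, ∀ e, comp (Sum.elim (C.deg (i + 1)) deg) e v ∈ K
  constantCoeff_eq : ∀ v ∈ K, ∀ b, constantCoeff (v b) = 0
  mem_iff : ∀ v : C.X (i + 1), inlMap V k _ r v ∈ K ↔ C.d i v = 0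

/-- The degrees of the generators. -/
abbrev Stage.degs {C : GradedFreeComplex V k} {n i : ℕ} (s : Stage C n i) :
    C.B (i + 1) ⊕ Fin s.r → ℕ :=
  Sum.elim (C.deg (i + 1)) s.deg

/-- The free module of a stage. -/
abbrev Stage.X {C : GradedFreeComplex V k} {n i : ℕ} (s : Stage C n i) : Type u :=
  C.B (i + 1) ⊕ Fin s.r →₀ MvPolynomial V k

/-- The complex `C` has its generators in the degrees of a linear strand that starts in degree
`n`, and its homology vanishes in the degrees that determine a linear strand. -/
structure IsLinearlyExact (C : GradedFreeComplex V k) (n : ℕ) : Prop where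
  deg_eq : ∀ i b, C.deg (i + 1) b = n + i
  eq_zero : ∀ i, ∀ v ∈ C.piece (i + 1) (n + i), C.d i v = 0 → v = 0
  exists_eq : ∀ i, ∀ v ∈ C.piece (i + 1) (n + i + 1), C.d i v = 0 →
    ∃ w ∈ C.piece (i + 2) (n + i + 1), C.d (i + 1) w = v

/-- The syzygies begin in degree `n + i + 1`, where they are exactly the images of the basis of `C`.
Completing these to a minimal generating set gives the next free module; its own syzygies have no
constant terms, by minimality. -/
theorem Stage.exists_next [Finite V] {C : GradedFreeComplex V k} {n : ℕ}
    (hC : IsLinearlyExact C n) (i : ℕ) (s : Stage C n i) :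
    ∃ (t : Stage C n (i + 1)) (d : t.X →ₗ[MvPolynomial V k] s.X),
      LinearMap.range d = s.K ∧ LinearMap.ker d = t.K ∧
      (∀ b, IsHom s.degs (t.degs b) (d (Finsupp.single b 1))) ∧
      ∀ v : C.X (i + 2), d (inlMap V k _ t.r v) = inlMap V k _ s.r (C.d (i + 1) v) := by
  have := C.finite_B (i + 1)
  have := C.finite_B (i + 2)
  let g₀ : C.B (i + 2) → s.X := fun b => inlMap V k _ s.r (C.d (i + 1) (Finsupp.single b 1))
  have hg₀d : ∀ v : C.X (i + 2), Finsupp.linearCombination (MvPolynomial V k) g₀ v =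
      inlMap V k _ s.r (C.d (i + 1) v) := by
    intro v
    refine LinearMap.congr_fun (f := Finsupp.linearCombination (MvPolynomial V k) g₀)
      (g := inlMap V k _ s.r ∘ₗ C.d (i + 1)) (Finsupp.lhom_ext fun b a => ?_) v
    have : (Finsupp.single b a : C.X (i + 2)) = a • Finsupp.single b 1 := by simp
    rw [this, map_smul, map_smul, Finsupp.linearCombination_single, one_smul]
    rfl
  have hdegs : ∀ b, n + i ≤ s.degs b := by
    rintro (b | j)
    · exact (hC.deg_eq i b).ge
    · exact (s.lt_deg j).le
  have hconst : ∀ v ∈ s.K, ∀ b, coeff 0 (v b) = 0 := s.constantCoeff_eq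
  obtain ⟨r, g₁, deg₁, hdeg₁, hhom₁, hspan, hmin⟩ := exists_minimal_generators (deg := s.degs)
    s.graded (e₀ := n + i + 1) (g₀ := g₀)
    (fun b => by
      rw [s.mem_iff]
      exact LinearMap.congr_fun (C.d_comp_d i) _)
    (fun b => by
      refine IsHom.inlMap (fun c u hu => ?_) _
      rw [C.homogeneous_d (i + 1) b c u hu, hC.deg_eq]
      omega)
    -- All generators have degree at least `n + i` and the syzygies have no constant terms, so
    -- nothing lives in degrees up to `n + i`.
    (fun e he v hv hve => by
      refine Finsupp.ext fun b => MvPolynomial.ext _ _ fun u => ?_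
      by_contra hu
      have h1 := hve b u hu
      have h2 := hdegs b
      obtain rfl := (Finsupp.degree_eq_zero_iff u).1 (by omega)
      exact hu (hconst v hv b))
    -- In degree `n + i + 1` an entry at an additional generator would be a constant, hence zero. So
    -- `v` is a cycle of `C`, and linear exactness makes it a boundary.
    (fun v hv hve => by
      have h0 : ∀ j, v (Sum.inr j) = 0 := by
        intro j
        ext u
        by_contra hu
        have h1 : u.degree + s.deg j = n + i + 1 := hve _ u hu
        have h2 := s.lt_deg j
        obtain rfl := (Finsupp.degree_eq_zero_iff u).1 (by omega)
        exact hu (hconst v hv _)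
      have h1 := inlMap_fstMap h0
      rw [← h1, s.mem_iff] at hv
      obtain ⟨w, -, hw⟩ := hC.exists_eq i _ (fun c u hu => hve (Sum.inl c) u hu) hv
      rw [← h1, ← hw, ← hg₀d, ← Finsupp.range_linearCombination]
      exact ⟨w, rfl⟩)
    (fun a ha h => by
      rw [hg₀d] at h
      refine hC.eq_zero (i + 1) a (fun c u hu => ?_) (inlMap_injective (h.trans (map_zero _).symm))
      rw [hC.deg_eq]
      exact ha c u hu)
  let d : (C.B (i + 2) ⊕ Fin r →₀ MvPolynomial V k) →ₗ[MvPolynomial V k] s.X :=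
    Finsupp.linearCombination (MvPolynomial V k) (Sum.elim g₀ g₁)
  have hd : ∀ v : C.X (i + 2), d (inlMap V k _ r v) = inlMap V k _ s.r (C.d (i + 1) v) := by
    intro v
    rw [← hg₀d]
    exact Finsupp.linearCombination_mapDomain _ _ _
  have hgr : ∀ b, IsHom s.degs (Sum.elim (C.deg (i + 2)) deg₁ b) (d (Finsupp.single b 1)) := by
    intro b
    rw [Finsupp.linearCombination_single, one_smul]
    cases b with
    | inl b =>
      refine IsHom.inlMap (fun c u hu => ?_) _
      exact C.homogeneous_d (i + 1) b c u hu
    | inr j => exact hhom₁ j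
  refine ⟨⟨r, deg₁, LinearMap.ker d, fun j => hdeg₁ j, ?_, hmin, ?_⟩, d, ?_, rfl, hgr, hd⟩
  · intro v hv e
    rw [LinearMap.mem_ker] at hv ⊢
    rw [← comp_map hgr, hv, map_zero]
  · intro v
    rw [LinearMap.mem_ker, hd]
    exact map_eq_zero_iff _ inlMap_injective
  · rw [Finsupp.range_linearCombination, hspan]

variable {C : GradedFreeComplex V k} {n : ℕ}

theorem isHom_d (C : GradedFreeComplex V k) (i : ℕ) (b : C.B (i + 1)) :
    IsHom (C.deg i) (C.deg (i + 1) b) (C.d i (Finsupp.single b 1)) :=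
  fun c u hu => C.homogeneous_d i b c u hu

theorem fstMap_single_inl {B : Type} {r : ℕ} (b : B) :
    fstMap V k B r (Finsupp.single (Sum.inl b) 1) = Finsupp.single b 1 := by
  have : (Finsupp.single (Sum.inl b) 1 : B ⊕ Fin r →₀ MvPolynomial V k) =
      inlMap V k B r (Finsupp.single b 1) := by
    simp
  rw [this, fstMap_inlMap]

/-- The first stage: no generators outside `C`, and the kernel of the last map of `C`. -/
def Stage.start (hC : IsLinearlyExact C n) : Stage C n 0 where
  r := 0
  deg := Fin.elim0
  K := LinearMap.ker (C.d 0 ∘ₗ fstMap V k (C.B 1) 0)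
  lt_deg j := j.elim0
  graded := by
    have := C.finite_B 0
    have := C.finite_B 1
    intro v hv e
    rw [LinearMap.mem_ker] at hv ⊢
    rw [← comp_map (deg := C.deg 0), hv, map_zero]
    rintro (b | j)
    · rw [LinearMap.comp_apply, fstMap_single_inl]
      exact isHom_d C 0 b
    · exact j.elim0
  constantCoeff_eq := by
    have := C.finite_B 0
    have := C.finite_B 1
    rintro v hv (b | j)
    · rw [LinearMap.mem_ker, LinearMap.comp_apply] at hv
      -- The constant terms of `v` sit in its component of degree `n`, on which `C.d 0` is
      -- injective.
      have h1 : C.d 0 (comp (C.deg 1) (n + 0) (fstMap V k (C.B 1) 0 v)) = 0 := by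
        rw [← comp_map (isHom_d C 0), hv, map_zero]
      have h2 := hC.eq_zero 0 _ (isHom_comp _ _ _) h1
      have h3 := congrArg (coeff 0) (DFunLike.congr_fun h2 b)
      rw [coeff_comp, if_pos (by rw [hC.deg_eq]; simp)] at h3
      exact h3
    · exact j.elim0
  mem_iff v := by
    rw [LinearMap.mem_ker, LinearMap.comp_apply, fstMap_inlMap]

/-! ### The image of the last map as a graded module, and its linear strand -/

/-- The grading of the image of the last map of `C`. -/
def rangeGrading (C : GradedFreeComplex V k) (e : ℕ) : AddSubgroup (LinearMap.range (C.d 0)) :=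
  (C.piece 0 e).comap (LinearMap.range (C.d 0)).subtype.toAddMonoidHom

theorem mem_rangeGrading {e : ℕ} {x : LinearMap.range (C.d 0)} :
    x ∈ rangeGrading C e ↔ IsHom (C.deg 0) e x.1 := Iff.rfl

/-- A homogeneous map commutes with taking components, so the components of an element of the image
stay in the image. -/
theorem isGradedModule_rangeGrading :
    IsGradedModule (V := V) (k := k) (rangeGrading C) := by
  classical
  have := C.finite_B 0
  have := C.finite_B 1
  refine ⟨⟨?_, ?_⟩, ?_⟩
  · rw [injective_iff_map_eq_zero]
    intro x hx
    have key : ∀ (e : ℕ) (x : DirectSum ℕ fun e => rangeGrading C e),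
        comp (C.deg 0) e (DirectSum.coeAddMonoidHom (rangeGrading C) x : _).1 = (x e).1.1 := by
      intro e x
      induction x using DirectSum.induction_on with
      | zero => simp
      | of d y =>
        rw [DirectSum.coeAddMonoidHom_of, (mem_rangeGrading.1 y.2).comp_eq]
        split_ifs with h
        · subst h
          rw [DirectSum.of_eq_same]
        · rw [DirectSum.of_eq_of_ne _ _ _ (Ne.symm h)]
          rfl
      | add x y hx hy =>
        rw [map_add, Submodule.coe_add, map_add, hx, hy]
        rfl
    refine DFinsupp.ext fun e => Subtype.ext (Subtype.ext ?_)
    have h := key e x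
    rw [hx] at h
    refine h.symm.trans ?_
    simp
  · rintro ⟨x, v, rfl⟩
    obtain ⟨M, hM⟩ := exists_eq_sum_comp (C.deg 1) v
    refine ⟨∑ e ∈ Finset.range M, DirectSum.of (fun e => rangeGrading C e) e
      ⟨⟨C.d 0 (comp (C.deg 1) e v), _, rfl⟩, ?_⟩, ?_⟩
    · rw [mem_rangeGrading]
      simp only
      rw [← comp_map (isHom_d C 0)]
      exact isHom_comp _ _ _
    · rw [map_sum]
      refine Subtype.ext ?_
      simp only [DirectSum.coeAddMonoidHom_of, AddSubmonoidClass.coe_finsetSum]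
      rw [← map_sum, ← hM]
  · intro i j a x ha hx c s hs
    by_contra hne
    refine hs ?_
    change coeff s (a * x.1 c) = 0
    rw [coeff_mul]
    refine Finset.sum_eq_zero fun p hp => ?_
    by_contra h
    have h1 := hx c p.2 (right_ne_zero_of_mul h)
    have h2 : p.1.degree = i := by
      rw [Finsupp.degree_eq_weight_one]
      exact ha (left_ne_zero_of_mul h)
    have h3 : s.degree = p.1.degree + p.2.degree := by
      rw [← Finset.HasAntidiagonal.mem_antidiagonal.1 hp, map_add]
    omega

/-- Linear exactness prevents `C.d 0` from killing the basis vector `b`, and all generators of the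
image lie in degree `n`. -/
theorem hasInitialDegree_rangeGrading (hC : IsLinearlyExact C n) (b : C.B 1) :
    HasInitialDegree (rangeGrading C) n := by
  have := C.finite_B 0
  have := C.finite_B 1
  constructor
  · intro h
    have h1 : (⟨C.d 0 (Finsupp.single b 1), _, rfl⟩ : LinearMap.range (C.d 0)) ∈
        rangeGrading C n := by
      have := isHom_d C 0 b
      rwa [hC.deg_eq] at this
    rw [h, AddSubgroup.mem_bot] at h1
    have h2 : C.d 0 (Finsupp.single b 1) = 0 := congrArg Subtype.val h1
    have h3 : IsHom (C.deg 1) (C.deg 1 b) (Finsupp.single b 1 : C.X 1) := isHom_single _ _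
    rw [hC.deg_eq] at h3
    have h4 := hC.eq_zero 0 _ h3 h2
    simp at h4
  · intro j hj
    rw [eq_bot_iff]
    rintro ⟨x, v, rfl⟩ hx
    rw [mem_rangeGrading] at hx
    have h1 := hx.comp_eq j
    simp only [if_true] at h1
    rw [comp_map (isHom_d C 0)] at h1
    have h2 : comp (C.deg 1) j v = 0 := by
      refine Finsupp.ext fun c => MvPolynomial.ext _ _ fun s => ?_
      rw [coeff_comp, if_neg (by rw [hC.deg_eq]; omega)]
      simp
    rw [AddSubgroup.mem_bot]
    refine Subtype.ext ?_
    rw [h2, map_zero] at h1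
    exact h1.symm

/-- Iterating `Stage.exists_next` from `Stage.start` yields the resolution. In homological degree
`i` the generators from `C` have degree `n + i` and the additional ones a larger degree, so the
linear strand is the summand coming from `C`. -/
theorem isAugmentedLinearStrand_rangeGrading [Finite V] (hC : IsLinearlyExact C n) :
    IsAugmentedLinearStrand C (rangeGrading C) n := by
  choose next d hrange hker hhom hcomm using Stage.exists_next hC
  let S : ∀ i, Stage C n i := fun i => Nat.rec (Stage.start hC) next i
  let F : GradedFreeComplex V k :=
    { B := fun i => C.B (i + 1) ⊕ Fin (S i).r
      finite_B := fun i => by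
        have := C.finite_B (i + 1)
        infer_instance
      deg := fun i => (S i).degs
      d := fun i => d i (S i)
      homogeneous_d := fun i b c s hs => hhom i (S i) b c s hs
      d_comp_d := fun i => by
        refine LinearMap.range_le_ker_iff.1 ?_
        rw [hker i (S i)]
        exact (hrange (i + 1) (S (i + 1))).le }
  let P : MinimalFreeResolution (V := V) (k := k) (rangeGrading C) :=
    { F := F
      ε := (C.d 0).rangeRestrict ∘ₗ fstMap V k (C.B 1) 0
      homogeneous_ε := by
        rintro (b | j)
        · have h : IsHom (C.deg 0) (C.deg 1 b)
              (C.d 0 (fstMap V k (C.B 1) 0 (Finsupp.single (Sum.inl b) 1))) := by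
            rw [fstMap_single_inl]
            exact isHom_d C 0 b
          exact h
        · exact j.elim0
      surjective_ε := by
        refine (LinearMap.surjective_rangeRestrict _).comp ?_
        exact Function.RightInverse.surjective fstMap_inlMap
      exact_zero := by
        rw [show LinearMap.range (F.d 0) = (S 0).K from hrange 0 (S 0)]
        refine Submodule.ext fun v => ?_
        rw [LinearMap.mem_ker, ← Submodule.coe_eq_zero]
        rfl
      exact_succ := fun i =>
        (hker i (S i)).trans (hrange (i + 1) (S (i + 1))).symm
      minimal := fun i b c => by
        refine (S i).constantCoeff_eq _ ?_ c
        rw [← hrange i (S i)]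
        exact ⟨_, rfl⟩ }
  let Φ : LinearStrandIso C.tail P.F n :=
    { φ := fun i => inlMap V k (C.B (i + 1)) (S i).r
      injective := fun i => inlMap_injective
      range_eq := fun i => by
        refine range_inlMap (fun b => ?_) fun j => ?_
        · exact (hC.deg_eq i b).trans (add_comm _ _)
        · have := (S i).lt_deg j
          omega
      homogeneous := fun i e v hv => IsHom.inlMap (deg := C.deg (i + 1)) hv _
      comm := fun i v => (hcomm i (S i) v).symm }
  refine ⟨P, Φ, (LinearMap.range (C.d 0)).subtype, Subtype.val_injective, fun e x hx => hx, ?_⟩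
  intro v
  exact (congrArg (C.d 0) (fstMap_inlMap (r := 0) v)).symm

end GradedFree

/-! ### Conclusion for the sparse Eagon–Northcott complex -/

namespace SparseEN

theorem isLinearlyExact {k : Type u} [Field k] {n m : ℕ}
    {Δ : PreAbstractSimplicialComplex (Fin m)}
    (hΔ : ∀ σ : Finset (Fin m), n + 1 ≤ σ.card → ¬ IsNonface Δ 1 σ) :
    GradedFree.IsLinearlyExact (sparseENComplex n k Δ) n where
  deg_eq _ _ := rfl
  eq_zero i _ hv h := eq_zero_of_mem_piece i hv h
  exists_eq i _ hv h := exists_d_eq_of_mem_piece hΔ i hv h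

end SparseEN

theorem GradedFreeComplex.subsingleton_homology {V : Type} {k : Type u} [Field k]
    (C : GradedFreeComplex V k) {i e : ℕ}
    (h : ∀ v ∈ C.piece (i + 1) e, C.d i v = 0 → ∃ w ∈ C.piece (i + 2) e, C.d (i + 1) w = v) :
    Subsingleton (C.homology (i + 1) e) := by
  have : ((C.piece (i + 1 + 1) e).map (C.d (i + 1)).toAddMonoidHom).addSubgroupOf
      (C.cycles (i + 1) ⊓ C.piece (i + 1) e) = ⊤ := by
    rw [AddSubgroup.addSubgroupOf_eq_top]
    rintro v ⟨hv, hv'⟩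
    exact h v hv' hv
  rw [GradedFreeComplex.homology, this]
  exact QuotientAddGroup.subsingleton_quotient_top

end

theorem mainTheorem4 {k : Type u} [Field k] {n m : ℕ} (hn : 1 ≤ n) (hnm : n ≤ m)
    (Δ : PreAbstractSimplicialComplex (Fin m))
    (hdim : ∃ σ ∈ Δ, n ≤ σ.card)
    (hΔ : ∀ σ : Finset (Fin m), n + 1 ≤ σ.card → ¬ IsNonface Δ 1 σ) :
    (∃ (N : Type u) (_ : AddCommGroup N) (_ : Module (SparseEN.Ring n m k) N)
      (𝒩 : ℕ → AddSubgroup N),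
      IsGradedModule (V := SparseEN.Vars n m) (k := k) 𝒩 ∧
      Module.Finite (SparseEN.Ring n m k) N ∧
      HasInitialDegree 𝒩 n ∧
      IsAugmentedLinearStrand (SparseEN.sparseENComplex n k Δ) 𝒩 n) ∧
    ∀ i : ℕ, 1 ≤ i →
      Subsingleton ((SparseEN.sparseENComplex n k Δ).homology i (i + n - 1)) ∧
      Subsingleton ((SparseEN.sparseENComplex n k Δ).homology i (i + n)) := by
  have hC := SparseEN.isLinearlyExact (k := k) hΔ
  constructor
  · have hV : Finite (SparseEN.Vars n m) := inferInstanceAs (Finite (Fin n × Fin m))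
    have hB := (SparseEN.sparseENComplex n k Δ).finite_B 1
    obtain ⟨σ, hσ, hcard⟩ := hdim
    -- A face with exactly `n` elements indexes a generator of degree `n`; `n ≥ 1` makes it
    -- nonempty, as membership in `Δ` requires.
    obtain ⟨τ, hτσ, hτ⟩ := Finset.exists_subset_card_eq hcard
    have hτΔ : τ ∈ Δ := (Δ.isRelLowerSet_faces hσ).2 hτσ (Finset.card_pos.1 (by omega))
    exact ⟨LinearMap.range ((SparseEN.sparseENComplex n k Δ).d 0), inferInstance, inferInstance,
      GradedFree.rangeGrading _, GradedFree.isGradedModule_rangeGrading,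
      Module.Finite.range _,
      GradedFree.hasInitialDegree_rangeGrading hC ⟨(0, τ), hτΔ, hτ, by simp⟩,
      GradedFree.isAugmentedLinearStrand_rangeGrading hC⟩
  · intro i hi
    obtain ⟨i, rfl⟩ : ∃ j, i = j + 1 := ⟨i - 1, by omega⟩
    have e1 : i + 1 + n - 1 = n + i := by omega
    have e2 : i + 1 + n = n + i + 1 := by omega
    rw [e1, e2]
    refine ⟨GradedFreeComplex.subsingleton_homology _ fun v hv h => ?_,
      GradedFreeComplex.subsingleton_homology _ (hC.exists_eq i)⟩
    exact ⟨0, AddSubgroup.zero_mem _, by rw [map_zero, hC.eq_zero i v hv h]⟩
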